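/- **Setting.** Let $m,t\ge 1$. A $\Pi_m\Sigma_3\Pi_t$ polynomial is given as a product $f=F_1\cdots F_m$ of $m$ clauses, where each clause $F_i=\sum_{j=1}^{r_i}T_{ij}$ is a sum of $1\le r_i\le 3$ terms and each term $T_{ij}$ is a product of at most $t$ variables, counted with multiplicity (variables are $x_0,x_1,x_2,\dots$; factors may come in any order and may repeat). Its sum-product expansion is the list of the monomials $\pi_1\cdots\pi_m$, one for each choice of a term $\pi_i$ of $F_i$ for every $i$ (without cancellation). A monomial is multilinear if every variable occurs in it with exponent at most $1$. The model of computation is the unit-cost random access machine: a program uses finitely many registers and a memory, all holding natural numbers; its instructions are loading a constant into a register, addition and truncated subtraction of registers, reading and writing the memory cell whose address is held in a register, and branching and looping on a test whether a register is nonzero; each instruction and each evaluation of a test costs one step. The input $f$ is written into the memory from address $0$ on as the sequence of words consisting of $m$, followed for each clause by its number of terms and for each of its terms by the degree of the term and the indices of its variables; all other memory cells and all registers are $0$ initially. **Theorem.** There are a single program and a constant $C$ such that for all $m,t\ge 1$ and every $\Pi_m\Sigma_3\Pi_t$ polynomial $f$, the program halts on input $f$ after at most $C\,t\,m^2\,1.7751^m$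 steps, with output (content of register $0$) $1$ if $f$ has a multilinear monomial in its sum-product expansion, and $0$ otherwise. Moreover, $f$ has a multilinear monomial in its sum-product expansion if and only if some multilinear monomial has a nonzero coefficient in $f$ regarded as an element of $\mathbb{Z}[x_0,x_1,\dots]$. -/

import Mathlib

namespace MonomialTesting

/-! ### Products of sums of terms -/

/-- A term: a product of variables, given by the list of the indices of its factors
(a repeated index is a repeated factor). -/
abbrev Term := List ℕ

/-- A clause: a sum of terms. -/
abbrev Clause := List Term

/-- A product of clauses. -/
abbrev Formula := List Clause

/-- `f` is a `Π_m Σ_s Π_t` polynomial (for `m, s, t ≥ 1`): a product of `m` clauses, each clause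
is a sum of at least one and at most `s` terms, and each term has degree at most `t`. -/
structure IsPiSigmaPi (m s t : ℕ) (f : Formula) : Prop where
  length_eq : f.length = m
  one_le_terms : ∀ F ∈ f, 1 ≤ F.length
  terms_le : ∀ F ∈ f, F.length ≤ s
  degree_le : ∀ F ∈ f, ∀ T ∈ F, T.length ≤ t

/-- The exponent vector of a product of variables. -/
noncomputable def Term.exponent (T : Term) : ℕ →₀ ℕ :=
  (T.map fun i => Finsupp.single i 1).sum

/-- The polynomial denoted by a term. -/
noncomputable def Term.toPoly (R : Type*) [CommSemiring R] (T : Term) : MvPolynomial ℕ R :=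
  (T.map MvPolynomial.X).prod

/-- The polynomial denoted by a clause. -/
noncomputable def Clause.toPoly (R : Type*) [CommSemiring R] (F : Clause) : MvPolynomial ℕ R :=
  (F.map (Term.toPoly R)).sum

/-- The polynomial denoted by a product of clauses. -/
noncomputable def Formula.toPoly (R : Type*) [CommSemiring R] (f : Formula) : MvPolynomial ℕ R :=
  (f.map (Clause.toPoly R)).prod

/-- The sum-product expansion: the list of the monomials (as exponent vectors)
`π_1 ⋯ π_m`, one for each way to choose a term `π_i` from the `i`-th clause. -/
noncomputable def Formula.expansion : Formula → List (ℕ →₀ ℕ)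
  | [] => [0]
  | F :: f => F.flatMap fun T => (Formula.expansion f).map fun d => Term.exponent T + d

/-- A monomial is multilinear if every variable occurs in it with exponent at most `1`. -/
def IsMultilinear (d : ℕ →₀ ℕ) : Prop := ∀ i, d i ≤ 1

/-- `f` has a multilinear monomial in its sum-product expansion. -/
def HasMultilinearMonomial (f : Formula) : Prop :=
  ∃ d ∈ Formula.expansion f, IsMultilinear d

theorem Term.toPoly_eq (R : Type*) [CommSemiring R] (T : Term) :
    Term.toPoly R T = MvPolynomial.monomial (Term.exponent T) 1 := by
  induction T with
  | nil => simp [Term.toPoly, Term.exponent]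
  | cons i T ih =>
    simp only [Term.toPoly, Term.exponent, List.map_cons, List.prod_cons, List.sum_cons] at ih ⊢
    rw [ih, MvPolynomial.X, MvPolynomial.monomial_mul, one_mul]

/-- Over every commutative semiring, the polynomial is the sum of the monomials in the list
`Formula.expansion f`. -/
theorem Formula.toPoly_eq_sum_expansion (R : Type*) [CommSemiring R] (f : Formula) :
    Formula.toPoly R f =
      ((Formula.expansion f).map fun d => MvPolynomial.monomial d (1 : R)).sum := by
  induction f with
  | nil => simp [Formula.toPoly, Formula.expansion]
  | cons F f ih =>
    have h : Formula.toPoly R (F :: f) = Clause.toPoly R F * Formula.toPoly R f := by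
      simp [Formula.toPoly]
    rw [h, ih]
    clear h ih
    induction F with
    | nil => simp [Clause.toPoly, Formula.expansion]
    | cons T F ihF =>
      have h : Clause.toPoly R (T :: F) = Term.toPoly R T + Clause.toPoly R F := by
        simp [Clause.toPoly]
      rw [h, add_mul, ihF, Term.toPoly_eq]
      simp only [Formula.expansion, List.flatMap_cons, List.map_append, List.sum_append,
        List.map_map]
      congr 1
      rw [← List.sum_map_mul_left]
      congr 1
      apply List.map_congr_left
      intro d _
      simp [MvPolynomial.monomial_mul]

/-! ### Random access machines with unit cost -/

/-- A state of the machine: the registers and the random access memory. Both hold natural numbers.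
A program mentions only finitely many registers. -/
@[ext]
structure State where
  reg : ℕ → ℕ
  mem : ℕ → ℕ

/-- Put the value `v` into register `d`. -/
def State.setReg (σ : State) (d v : ℕ) : State :=
  { σ with reg := Function.update σ.reg d v }

/-- Put the value `v` into the memory cell with address `a`. -/
def State.setMem (σ : State) (a v : ℕ) : State :=
  { σ with mem := Function.update σ.mem a v }

/-- Programs of a random access machine, with structured control flow. The only arithmetic
instructions are addition and truncated subtraction; there is no multiplication. -/
inductive Program where
  /-- `R_d := c` -/
  | const (d c : ℕ)
  /-- `R_d := R_a + R_b` -/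
  | add (d a b : ℕ)
  /-- `R_d := max (R_a - R_b) 0` -/
  | sub (d a b : ℕ)
  /-- `R_d := M[R_a]` -/
  | load (d a : ℕ)
  /-- `M[R_a] := R_b` -/
  | store (a b : ℕ)
  /-- first `p`, then `q` -/
  | seq (p q : Program)
  /-- if `R_a ≠ 0` then `p` else `q` -/
  | ifNonzero (a : ℕ) (p q : Program)
  /-- while `R_a ≠ 0` do `p` -/
  | whileNonzero (a : ℕ) (p : Program)

/-- `Runs p σ T τ`: started in the state `σ`, the program `p` halts in the state `τ` after exactly
`T` steps. Every instruction costs one step, and so does every evaluation of the test of a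
conditional or of a loop. -/
inductive Runs : Program → State → ℕ → State → Prop where
  | const (σ : State) (d c : ℕ) : Runs (.const d c) σ 1 (σ.setReg d c)
  | add (σ : State) (d a b : ℕ) : Runs (.add d a b) σ 1 (σ.setReg d (σ.reg a + σ.reg b))
  | sub (σ : State) (d a b : ℕ) : Runs (.sub d a b) σ 1 (σ.setReg d (σ.reg a - σ.reg b))
  | load (σ : State) (d a : ℕ) : Runs (.load d a) σ 1 (σ.setReg d (σ.mem (σ.reg a)))
  | store (σ : State) (a b : ℕ) : Runs (.store a b) σ 1 (σ.setMem (σ.reg a) (σ.reg b))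
  | seq {p q : Program} {σ τ υ : State} {T U : ℕ} :
      Runs p σ T τ → Runs q τ U υ → Runs (.seq p q) σ (T + U) υ
  | ifTrue {a : ℕ} {p q : Program} {σ τ : State} {T : ℕ} :
      σ.reg a ≠ 0 → Runs p σ T τ → Runs (.ifNonzero a p q) σ (T + 1) τ
  | ifFalse {a : ℕ} {p q : Program} {σ τ : State} {T : ℕ} :
      σ.reg a = 0 → Runs q σ T τ → Runs (.ifNonzero a p q) σ (T + 1) τ
  | whileFalse {a : ℕ} {p : Program} {σ : State} :
      σ.reg a = 0 → Runs (.whileNonzero a p) σ 1 σ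
  | whileTrue {a : ℕ} {p : Program} {σ τ υ : State} {T U : ℕ} :
      σ.reg a ≠ 0 → Runs p σ T τ → Runs (.whileNonzero a p) τ U υ →
        Runs (.whileNonzero a p) σ (T + 1 + U) υ

/-- The machine is deterministic: the number of steps and the final state are unique. -/
theorem Runs.unique {p : Program} {σ τ τ' : State} {T T' : ℕ}
    (h : Runs p σ T τ) (h' : Runs p σ T' τ') : T = T' ∧ τ = τ' := by
  induction h generalizing T' τ' with
  | const | add | sub | load | store => cases h'; exact ⟨rfl, rfl⟩
  | seq _ _ ih₁ ih₂ =>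
    cases h' with
    | seq k₁ k₂ =>
      obtain ⟨rfl, rfl⟩ := ih₁ k₁
      obtain ⟨rfl, rfl⟩ := ih₂ k₂
      exact ⟨rfl, rfl⟩
  | ifTrue h₀ _ ih =>
    cases h' with
    | ifTrue _ k =>
      obtain ⟨rfl, rfl⟩ := ih k
      exact ⟨rfl, rfl⟩
    | ifFalse k₀ _ => exact absurd k₀ h₀
  | ifFalse h₀ _ ih =>
    cases h' with
    | ifTrue k₀ _ => exact absurd h₀ k₀
    | ifFalse _ k =>
      obtain ⟨rfl, rfl⟩ := ih k
      exact ⟨rfl, rfl⟩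
  | whileFalse h₀ =>
    cases h' with
    | whileFalse _ => exact ⟨rfl, rfl⟩
    | whileTrue k₀ _ _ => exact absurd h₀ k₀
  | whileTrue h₀ _ _ ih₁ ih₂ =>
    cases h' with
    | whileFalse k₀ => exact absurd k₀ h₀
    | whileTrue _ k₁ k₂ =>
      obtain ⟨rfl, rfl⟩ := ih₁ k₁
      obtain ⟨rfl, rfl⟩ := ih₂ k₂
      exact ⟨rfl, rfl⟩

/-- The input words: the number of clauses, then for each clause its number of terms, and for
each of its terms the degree followed by the indices of its variables. -/
def Formula.encode (f : Formula) : List ℕ :=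
  f.length :: f.flatMap fun F => F.length :: F.flatMap fun T => T.length :: T

/-- The initial state on input `f`: the input words stand in the memory from address `0` on; all
other memory cells and all registers hold `0`. -/
def initialState (f : Formula) : State where
  reg := fun _ => 0
  mem := fun a => (Formula.encode f).getD a 0

end MonomialTesting

set_option linter.unusedSimpArgs false

namespace MonomialTesting

/-! ### Weakest preconditions with time -/

/-! A multilinear monomial in the expansion is a choice of one term per clause such that every
chosen term is squarefree and any two of them have no common variable. This is a system of binary
conflicts between at most three items per clause (`hasMultilinearMonomial_iff_solvable`). With two
items per clause it would be a 2-SAT instance, solvable in polynomial time.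

To get there, the clauses are grouped into `k = ⌈m/2⌉` pairs, and for each pair one digit in `{0, 1,
2}` is guessed: the term with that number is deleted from both clauses of the pair. A choice uses at
most two numbers in a pair, so every solution survives some sequence of digits
(`exists_compatible`). There are `3 ^ k` sequences, about `√3 ^ m`.

The remaining choices between two items `a` and `b` are eliminated one after the other, as in
resolution: if `p` excludes `a` and `q` excludes `b`, then `p` and `q` become a conflict. An
independent set for the new conflicts extends by `a` or `b` (`Elim.extend`), and no independent set
that contains `a` or `b` is lost (`Elim.sound`). One additional item, the empty term, is always
selected. It makes the set to be extended nonempty and lets a non-squarefree term be recorded as a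
binary conflict; after all eliminations its conflict with itself is the only obstruction left
(`solvable_end_iff`).

One sequence of digits costs `O(m ^ 4)` steps, where one factor `m` comes from addressing matrix
entries by repeated addition; the conflict matrix is computed once, in time `O(t m ^ 2 + m ^ 3)`.
Since `√3 < 1.7321 < 1.7751`, the exponential gap absorbs the surplus powers of `m`
(`exists_const_bound`). The machine part consists of Hoare-style specifications with time bounds, in
which `wp_while` handles every loop. -/

/-- Started in `σ`, the program halts after some number `T` of steps in a state `τ` with `Q T τ`. -/
def wp (P : Program) (Q : ℕ → State → Prop) (σ : State) : Prop :=
  ∃ T τ, Runs P σ T τ ∧ Q T τ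

theorem wp.mono {P : Program} {Q Q' : ℕ → State → Prop} {σ : State} (h : wp P Q σ)
    (hQ : ∀ T τ, Q T τ → Q' T τ) : wp P Q' σ := by
  obtain ⟨T, τ, h₁, h₂⟩ := h
  exact ⟨T, τ, h₁, hQ _ _ h₂⟩

theorem wp_const {d c : ℕ} {Q : ℕ → State → Prop} {σ : State} :
    wp (.const d c) Q σ ↔ Q 1 (σ.setReg d c) :=
  ⟨fun ⟨_, _, h, hQ⟩ => by cases h; exact hQ, fun h => ⟨_, _, .const .., h⟩⟩

theorem wp_add {d a b : ℕ} {Q : ℕ → State → Prop} {σ : State} :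
    wp (.add d a b) Q σ ↔ Q 1 (σ.setReg d (σ.reg a + σ.reg b)) :=
  ⟨fun ⟨_, _, h, hQ⟩ => by cases h; exact hQ, fun h => ⟨_, _, .add .., h⟩⟩

theorem wp_sub {d a b : ℕ} {Q : ℕ → State → Prop} {σ : State} :
    wp (.sub d a b) Q σ ↔ Q 1 (σ.setReg d (σ.reg a - σ.reg b)) :=
  ⟨fun ⟨_, _, h, hQ⟩ => by cases h; exact hQ, fun h => ⟨_, _, .sub .., h⟩⟩

theorem wp_load {d a : ℕ} {Q : ℕ → State → Prop} {σ : State} :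
    wp (.load d a) Q σ ↔ Q 1 (σ.setReg d (σ.mem (σ.reg a))) :=
  ⟨fun ⟨_, _, h, hQ⟩ => by cases h; exact hQ, fun h => ⟨_, _, .load .., h⟩⟩

theorem wp_store {a b : ℕ} {Q : ℕ → State → Prop} {σ : State} :
    wp (.store a b) Q σ ↔ Q 1 (σ.setMem (σ.reg a) (σ.reg b)) :=
  ⟨fun ⟨_, _, h, hQ⟩ => by cases h; exact hQ, fun h => ⟨_, _, .store .., h⟩⟩

theorem wp_seq {p q : Program} {Q : ℕ → State → Prop} {σ : State} :
    wp (.seq p q) Q σ ↔ wp p (fun T τ => wp q (fun U υ => Q (T + U) υ) τ) σ := by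
  constructor
  · rintro ⟨_, _, h, hQ⟩
    cases h with
    | seq h₁ h₂ => exact ⟨_, _, h₁, _, _, h₂, hQ⟩
  · rintro ⟨_, _, h₁, _, _, h₂, hQ⟩
    exact ⟨_, _, .seq h₁ h₂, hQ⟩

theorem wp_if_pos {a : ℕ} {p q : Program} {Q : ℕ → State → Prop} {σ : State}
    (h : σ.reg a ≠ 0) (hp : wp p (fun T τ => Q (T + 1) τ) σ) : wp (.ifNonzero a p q) Q σ := by
  obtain ⟨T, τ, h₁, h₂⟩ := hp
  exact ⟨_, _, .ifTrue h h₁, h₂⟩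

theorem wp_if_neg {a : ℕ} {p q : Program} {Q : ℕ → State → Prop} {σ : State}
    (h : σ.reg a = 0) (hq : wp q (fun T τ => Q (T + 1) τ) σ) : wp (.ifNonzero a p q) Q σ := by
  obtain ⟨T, τ, h₁, h₂⟩ := hq
  exact ⟨_, _, .ifFalse h h₁, h₂⟩

/-- The rule for loops: an invariant indexed by the number of rounds that are still to come,
and a bound `B` for the time of one round. -/
theorem wp_while {a : ℕ} {p : Program} (I : ℕ → State → Prop) (B : ℕ)
    (h₀ : ∀ σ, I 0 σ → σ.reg a = 0)
    (h₁ : ∀ n σ, I (n + 1) σ → σ.reg a ≠ 0 ∧ wp p (fun T τ => T ≤ B ∧ I n τ) σ)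
    (n : ℕ) (σ : State) (h : I n σ) :
    wp (.whileNonzero a p) (fun T τ => T ≤ n * (B + 1) + 1 ∧ I 0 τ) σ := by
  induction n generalizing σ with
  | zero => exact ⟨_, _, .whileFalse (h₀ σ h), by simp, h⟩
  | succ n ih =>
    obtain ⟨ha, T, τ, hr, hT, hI⟩ := h₁ n σ h
    obtain ⟨U, υ, hr', hU, hI'⟩ := ih τ hI
    refine ⟨_, _, .whileTrue ha hr hr', ?_, hI'⟩
    rw [Nat.succ_mul]
    omega

/-! ### Reading registers and memory after an assignment. -/

theorem setReg_reg_self (σ : State) (d v : ℕ) : (σ.setReg d v).reg d = v := by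
  simp [State.setReg]

theorem setReg_reg_ne (σ : State) {d r : ℕ} (v : ℕ) (h : r ≠ d) :
    (σ.setReg d v).reg r = σ.reg r := by
  simp [State.setReg, h]

theorem setReg_mem (σ : State) (d v : ℕ) : (σ.setReg d v).mem = σ.mem := rfl

theorem setMem_reg (σ : State) (a v : ℕ) : (σ.setMem a v).reg = σ.reg := rfl

theorem setMem_mem (σ : State) (a v : ℕ) : (σ.setMem a v).mem = Function.update σ.mem a v := rfl

/-! ### Small programs -/

infixr:60 " ;; " => Program.seq

/-- Does nothing of interest. -/
def skip : Program := .const 39 0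

/-- `R_d := R_a` -/
def mov (d a : ℕ) : Program := .const d 0 ;; .add d d a

/-- `R₃₀ := R_b + R_q + R₄ * R_p`, the address of the entry `(p, q)` of a matrix with rows of
length `R₄` that starts at the address `R_b` -/
def cell (b p q : ℕ) : Program :=
  mov 30 b ;; .add 30 30 q ;; mov 32 p ;;
    .whileNonzero 32 (.add 30 30 4 ;; .sub 32 32 9)

/-- `R_d :=` the entry `(p, q)` -/
def get (d b p q : ℕ) : Program := cell b p q ;; .load d 30

/-- the entry `(p, q)` becomes `R_v` -/
def put (b p q v : ℕ) : Program := cell b p q ;; .store 30 v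

theorem wp_mov {d a : ℕ} (h : a ≠ d) {Q : ℕ → State → Prop} {σ : State}
    (hQ : Q 2 ((σ.setReg d 0).setReg d (σ.reg a))) : wp (mov d a) Q σ := by
  simpa (disch := omega) only [mov, wp_seq, wp_const, wp_add, setReg_reg_self, setReg_reg_ne,
    zero_add] using hQ

/-- Without multiplication the product is accumulated by `R_p` additions, and the loop keeps `R₃₀ +
R₄ * j` constant, with `j` the number of rounds to come. The resulting linear cost of every matrix
access accounts for one factor `n` in the later bounds. Register `9` holds the constant `1`
throughout. -/
theorem cell_spec (b p q : ℕ) (hb : b < 30) (hp : p < 30) (hq : q < 30) (σ : State)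
    (h9 : σ.reg 9 = 1) :
    wp (cell b p q) (fun T τ => T ≤ 3 * σ.reg p + 6 ∧
      τ.reg 30 = σ.reg b + σ.reg q + σ.reg 4 * σ.reg p ∧
      (∀ r < 30, τ.reg r = σ.reg r) ∧ τ.mem = σ.mem) σ := by
  simp only [cell, wp_seq]
  apply wp_mov (by omega)
  rw [wp_add]
  apply wp_mov (by omega)
  refine (wp_while (fun j τ => τ.reg 32 = j ∧
      τ.reg 30 + σ.reg 4 * j = σ.reg b + σ.reg q + σ.reg 4 * σ.reg p ∧
      (∀ r < 30, τ.reg r = σ.reg r) ∧ τ.mem = σ.mem) 2 (fun τ h => h.1) ?_ (σ.reg p) _ ?_).mono ?_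
  · rintro j τ ⟨h32, h30, hr, hm⟩
    refine ⟨by omega, ?_⟩
    simp (disch := omega) only [wp_seq, wp_add, wp_sub, setReg_reg_self, setReg_reg_ne, setReg_mem,
      hr, hm, h32, h9]
    refine ⟨le_rfl, rfl, ?_, ?_, trivial⟩
    · rw [← h30]; ring
    · intro r hlt
      simp (disch := omega) only [setReg_reg_ne, hr]
  · simp (disch := omega) only [setReg_reg_self, setReg_reg_ne, setReg_mem]
    refine ⟨trivial, trivial, ?_, trivial⟩
    intro r hlt
    simp (disch := omega) only [setReg_reg_ne]
  · rintro T τ ⟨hT, -, h30, hr, hm⟩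
    exact ⟨by omega, by simpa using h30, hr, hm⟩

theorem wp_get {d b p q : ℕ} (hb : b < 30) (hp : p < 30) (hq : q < 30)
    {σ : State} (h9 : σ.reg 9 = 1) {Q : ℕ → State → Prop}
    (hQ : ∀ T τ, T ≤ 3 * σ.reg p + 7 →
      τ.reg d = σ.mem (σ.reg b + σ.reg q + σ.reg 4 * σ.reg p) →
      (∀ r < 30, r ≠ d → τ.reg r = σ.reg r) → τ.mem = σ.mem → Q T τ) :
    wp (get d b p q) Q σ := by
  rw [get, wp_seq]
  refine (cell_spec b p q hb hp hq σ h9).mono ?_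
  rintro T τ ⟨hT, h30, hr, hm⟩
  rw [wp_load]
  refine hQ _ _ (by omega) ?_ ?_ hm
  · rw [setReg_reg_self, h30, hm]
  · intro r hlt hne
    rw [setReg_reg_ne _ _ hne, hr r hlt]

theorem wp_put {b p q v : ℕ} (hb : b < 30) (hp : p < 30) (hq : q < 30) (hv : v < 30)
    {σ : State} (h9 : σ.reg 9 = 1) {Q : ℕ → State → Prop}
    (hQ : ∀ T τ, T ≤ 3 * σ.reg p + 7 →
      (∀ r < 30, τ.reg r = σ.reg r) →
      τ.mem = Function.update σ.mem (σ.reg b + σ.reg q + σ.reg 4 * σ.reg p) (σ.reg v) → Q T τ) :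
    wp (put b p q v) Q σ := by
  rw [put, wp_seq]
  refine (cell_spec b p q hb hp hq σ h9).mono ?_
  rintro T τ ⟨hT, h30, hr, hm⟩
  rw [wp_store]
  refine hQ _ _ (by omega) hr ?_
  rw [setMem_mem, h30, hm, hr v hv]

/-! ### Elimination of a two-valued choice from a system of binary conflicts -/

/-- No two members of `S` (equal or not) are in conflict. -/
def Indep (D : ℕ → ℕ → Prop) (S : Set ℕ) : Prop := ∀ p ∈ S, ∀ q ∈ S, ¬ D p q

/-- The state of the elimination of a choice between `a` and `b` from the conflicts `D` between
the items below `n`: the conflicts are now `D'`, and the pairs in `done` have been treated. -/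
structure Elim (n : ℕ) (D : ℕ → ℕ → Prop) (a b : ℕ) (done D' : ℕ → ℕ → Prop) : Prop where
  le : ∀ p q, D p q → D' p q
  symm : ∀ p q, D' p q → D' q p
  forces : ∀ p q, p < n → q < n → done p q → (D p a ∨ D a a) → (D q b ∨ D b b) → D' p q
  sound : ∀ S, a ∈ S ∨ b ∈ S → Indep D S → Indep D' S

theorem Elim.refl {n : ℕ} {D : ℕ → ℕ → Prop} (a b : ℕ) {done : ℕ → ℕ → Prop}
    (hs : ∀ p q, D p q → D q p) (hd : ∀ p q, p < n → q < n → ¬ done p q) :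
    Elim n D a b done D where
  le _ _ h := h
  symm := hs
  forces p q hp hq h := absurd h (hd p q hp hq)
  sound _ _ h := h

theorem Elim.congr_done {n : ℕ} {D D' done done' : ℕ → ℕ → Prop} {a b : ℕ}
    (h : Elim n D a b done D') (hd : ∀ p q, p < n → q < n → done' p q → done p q) :
    Elim n D a b done' D' :=
  ⟨h.le, h.symm, fun p q hp hq h' => h.forces p q hp hq (hd p q hp hq h'), h.sound⟩

/-- The matrix is updated in place, so the test reads the current `D'` and not the original `D`.
This is harmless: `D'` contains `D`, so all required conflicts are still produced, and a conflict
derived from `D'` holds for every independent set containing `a` or `b`, because such a set is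
independent for `D'` already. -/
theorem Elim.step {n : ℕ} {D D' D'' done : ℕ → ℕ → Prop} {a b p₀ q₀ : ℕ}
    (h : Elim n D a b done D')
    (hD : ∀ p q, D'' p q ↔ D' p q ∨ ((D' p₀ a ∨ D' a a) ∧ (D' q₀ b ∨ D' b b)) ∧
      (p = p₀ ∧ q = q₀ ∨ p = q₀ ∧ q = p₀)) :
    Elim n D a b (fun p q => done p q ∨ p = p₀ ∧ q = q₀) D'' where
  le p q hpq := (hD p q).2 (.inl (h.le p q hpq))
  symm p q hpq := by
    rw [hD] at hpq ⊢
    rcases hpq with hpq | ⟨h₁, h₂⟩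
    · exact .inl (h.symm _ _ hpq)
    · exact .inr ⟨h₁, by tauto⟩
  forces p q hp hq hdone ha hb := by
    rw [hD]
    rcases hdone with hdone | ⟨rfl, rfl⟩
    · exact .inl (h.forces p q hp hq hdone ha hb)
    · exact .inr ⟨⟨ha.imp (h.le _ _) (h.le _ _), hb.imp (h.le _ _) (h.le _ _)⟩, .inl ⟨rfl, rfl⟩⟩
  sound S hS hi p hp q hq hpq := by
    have hi' := h.sound S hS hi
    rw [hD] at hpq
    rcases hpq with hpq | ⟨⟨ha, hb⟩, heq⟩
    · exact hi' p hp q hq hpq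
    · have hp₀ : p₀ ∈ S := by rcases heq with ⟨rfl, rfl⟩ | ⟨rfl, rfl⟩ <;> assumption
      have hq₀ : q₀ ∈ S := by rcases heq with ⟨rfl, rfl⟩ | ⟨rfl, rfl⟩ <;> assumption
      rcases hS with hS | hS
      · rcases ha with ha | ha
        · exact hi' _ hp₀ _ hS ha
        · exact hi' _ hS _ hS ha
      · rcases hb with hb | hb
        · exact hi' _ hq₀ _ hS hb
        · exact hi' _ hS _ hS hb

/-- If a set is independent after the elimination, it can be extended by `a` or by `b`. -/
theorem Elim.extend {n : ℕ} {D D' : ℕ → ℕ → Prop} {a b : ℕ}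
    (h : Elim n D a b (fun _ _ => True) D') (hs : ∀ p q, D p q → D q p) {S : Set ℕ}
    (hn : ∀ p ∈ S, p < n) (hne : S.Nonempty) (hi : Indep D' S) :
    Indep D (insert a S) ∨ Indep D (insert b S) := by
  have key : ∀ x, ¬ D x x → (∀ p ∈ S, ¬ D p x) → Indep D (insert x S) := by
    rintro x hx hS p (rfl | hp) q (rfl | hq) hpq
    · exact hx hpq
    · exact hS q hq (hs _ _ hpq)
    · exact hS p hp hpq
    · exact hi p hp q hq (h.le _ _ hpq)
  -- If `x` conflicts only with itself, an arbitrary member of `S` serves as the witness; this is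
  -- where `S` has to be nonempty.
  have key' : ∀ x, ¬ Indep D (insert x S) → ∃ p ∈ S, D p x ∨ D x x := by
    intro x hx
    by_contra! hc
    obtain ⟨s, hS⟩ := hne
    exact hx (key x (hc s hS).2 fun p hp => (hc p hp).1)
  -- If both extensions fail, some `p` in `S` excludes `a` and some `q` in `S` excludes `b`, so the
  -- elimination has made `p` and `q` a conflict inside `S`.
  by_contra! hc
  obtain ⟨p, hp, hpa⟩ := key' a hc.1
  obtain ⟨q, hq, hqb⟩ := key' b hc.2
  exact hi p hp q hq (h.forces p q (hn p hp) (hn q hq) trivial hpa hqb)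

/-! ### Choosing one item from every clause -/

/-- The items `3 i + c i` with `j ≤ i < L`, and the item `3 L`. -/
def selection (L j : ℕ) (c : ℕ → ℕ) : Set ℕ :=
  {p | p = 3 * L ∨ ∃ i, j ≤ i ∧ i < L ∧ p = 3 * i + c i}

/-- One can choose one of the items `3 i`, `3 i + 1`, `3 i + 2` for every `i` with `j ≤ i < L`,
such that there are no conflicts. -/
def Solvable (L : ℕ) (D : ℕ → ℕ → Prop) (j : ℕ) : Prop :=
  ∃ c : ℕ → ℕ, (∀ i, c i < 3) ∧ Indep D (selection L j c)

/-- A solution for the later clauses extends to clause `j` by one of its two remaining items. The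
permanent item `3 * L` provides the nonempty set that `Elim.extend` asks for. -/
theorem Elim.solvable {L j x y : ℕ} {D D' : ℕ → ℕ → Prop}
    (h : Elim (3 * L + 1) D (3 * j + x) (3 * j + y) (fun _ _ => True) D')
    (hs : ∀ p q, D p q → D q p) (hx : x < 3) (hy : y < 3)
    (hg : Solvable L D' (j + 1)) : Solvable L D j := by
  obtain ⟨c, hc, hi⟩ := hg
  have key : ∀ z, z < 3 → Indep D (insert (3 * j + z) (selection L (j + 1) c)) →
      Solvable L D j := by
    intro z hz hI
    have hsub : selection L j (Function.update c j z) ⊆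
        insert (3 * j + z) (selection L (j + 1) c) := by
      rintro p (rfl | ⟨i, hi₁, hi₂, rfl⟩)
      · exact .inr (.inl rfl)
      · rcases hi₁.eq_or_lt with rfl | hlt
        · left; simp
        · refine .inr (.inr ⟨i, hlt, hi₂, ?_⟩)
          rw [Function.update_of_ne (by omega)]
    refine ⟨Function.update c j z, fun i => ?_, fun p hp q hq =>
      hI p (hsub hp) q (hsub hq)⟩
    by_cases hij : i = j
    · subst hij; simpa using hz
    · rw [Function.update_of_ne hij]; exact hc i
  have hn : ∀ p ∈ selection L (j + 1) c, p < 3 * L + 1 := by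
    rintro p (rfl | ⟨i, hi₁, hi₂, rfl⟩)
    · omega
    · have := hc i; omega
  rcases h.extend hs hn ⟨3 * L, .inl rfl⟩ hi with h | h
  · exact key _ hx h
  · exact key _ hy h

/-- The opposite direction: a solution survives the elimination of clause `j` as long as its choice
there is not the deleted item. -/
theorem Elim.indep_selection {L j x y : ℕ} {D D' : ℕ → ℕ → Prop} {c : ℕ → ℕ}
    (h : Elim (3 * L + 1) D (3 * j + x) (3 * j + y) (fun _ _ => True) D') (hj : j < L)
    (hc : c j = x ∨ c j = y) (hi : Indep D (selection L 0 c)) : Indep D' (selection L 0 c) := by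
  refine h.sound _ (hc.imp ?_ ?_) hi <;>
  · rintro rfl
    exact .inr ⟨j, Nat.zero_le _, hj, rfl⟩

/-- Only the permanent item is left, and its conflict with itself plays the role of the empty clause
in resolution. -/
theorem solvable_end_iff {L : ℕ} {D : ℕ → ℕ → Prop} :
    Solvable L D L ↔ ¬ D (3 * L) (3 * L) := by
  have hsel : ∀ c, selection L L c = {3 * L} := by
    intro c
    ext p
    simp only [selection, Set.mem_ofPred_eq, Set.mem_singleton_iff, or_iff_left_iff_imp]
    rintro ⟨i, h₁, h₂, -⟩
    omega
  constructor
  · rintro ⟨c, -, hi⟩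
    exact hi _ (.inl rfl) _ (.inl rfl)
  · intro h
    refine ⟨fun _ => 0, by simp, ?_⟩
    rw [hsel]
    rintro p rfl q rfl
    exact h

/-! ### The digits of a number below `3 ^ k`, the leading one first -/

/-- What is left after `l` digits of `r / K`. -/
def remainder (K r : ℕ) : ℕ → ℕ
  | 0 => r
  | l + 1 => 3 * remainder K r l % K

/-- The `l`-th ternary digit of `r / K` after the point. -/
def digit (K r l : ℕ) : ℕ := 3 * remainder K r l / K

theorem remainder_lt {K r : ℕ} (h : r < K) (l : ℕ) : remainder K r l < K := by
  cases l with
  | zero => exact h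
  | succ l => exact Nat.mod_lt _ (by omega)

theorem remainder_succ' (K r l : ℕ) : remainder K r (l + 1) = remainder K (3 * r % K) l := by
  induction l with
  | zero => rfl
  | succ l ih => rw [remainder, ih]; rfl

/-- Every sequence of digits occurs. -/
theorem exists_digit_eq (k : ℕ) (δ : ℕ → ℕ) (hδ : ∀ l, δ l < 3) :
    ∃ r < 3 ^ k, ∀ l < k, digit (3 ^ k) r l = δ l := by
  -- For the induction the modulus `K` stays fixed: passing to the next digit turns `P` into `3 *
  -- P`, and the numbers considered are the multiples `P * s`.
  have key : ∀ (j : ℕ) (K P : ℕ) (δ : ℕ → ℕ), (∀ l, δ l < 3) → 0 < P → K = P * 3 ^ j →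
      ∃ s < 3 ^ j, ∀ l < j, digit K (P * s) l = δ l := by
    intro j
    induction j with
    | zero => intro K P δ _ _ _; exact ⟨0, by simp, by simp⟩
    | succ j ih =>
      intro K P δ hδ hP hK
      obtain ⟨s, hs, hd⟩ := ih K (P * 3) (fun l => δ (l + 1)) (fun l => hδ _) (by omega)
        (by rw [hK]; ring)
      have h0 := hδ 0
      -- Splits off the leading digit: `δ 0` is the quotient by `K`, and the multiple `P * 3 * s <
      -- K` is the remainder to which induction applies.
      have e : 3 * (P * (δ 0 * 3 ^ j + s)) = P * 3 * s + K * δ 0 := by rw [hK]; ring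
      have hlt : P * 3 * s < K := by
        rw [hK, pow_succ', ← mul_assoc]
        exact Nat.mul_lt_mul_of_pos_left hs (by omega)
      refine ⟨δ 0 * 3 ^ j + s, ?_, ?_⟩
      · rw [pow_succ]
        nlinarith
      · intro l hl
        cases l with
        | zero =>
          rw [digit, remainder, e, Nat.add_mul_div_left _ _ (by omega), Nat.div_eq_of_lt hlt,
            zero_add]
        | succ l =>
          rw [digit, remainder_succ', e, Nat.add_mul_mod_self_left, Nat.mod_eq_of_lt hlt]
          exact hd l (by omega)
  obtain ⟨s, hs, hd⟩ := key k (3 ^ k) 1 δ hδ one_pos (by simp)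
  exact ⟨s, hs, by simpa using hd⟩

/-! ### Multilinear monomials and conflicts of terms -/

theorem exponent_apply (T : Term) (i : ℕ) : Term.exponent T i = T.count i := by
  induction T with
  | nil => simp [Term.exponent]
  | cons x T ih =>
    simp only [Term.exponent, List.map_cons, List.sum_cons, Finsupp.add_apply] at ih ⊢
    rw [ih, List.count_cons, Finsupp.single_apply, add_comm]
    simp

theorem isMultilinear_exponent {T : Term} : IsMultilinear (Term.exponent T) ↔ T.Nodup := by
  simp [IsMultilinear, exponent_apply, List.nodup_iff_count_le_one]

theorem mem_expansion {f : Formula} {d : ℕ →₀ ℕ} :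
    d ∈ Formula.expansion f ↔
      ∃ ts : List Term, List.Forall₂ (fun T F => T ∈ F) ts f ∧ Term.exponent ts.flatten = d := by
  induction f generalizing d with
  | nil => simp [Formula.expansion, Term.exponent, eq_comm]
  | cons F f ih =>
    simp only [Formula.expansion, List.mem_flatMap, List.mem_map, ih, List.forall₂_cons_right_iff]
    constructor
    · rintro ⟨T, hT, _, ⟨ts, hts, rfl⟩, rfl⟩
      exact ⟨T :: ts, ⟨T, ts, hT, hts, rfl⟩, by simp [Term.exponent]⟩
    · rintro ⟨_, ⟨T, ts, hT, hts, rfl⟩, rfl⟩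
      exact ⟨T, hT, _, ⟨ts, hts, rfl⟩, by simp [Term.exponent]⟩

theorem hasMultilinearMonomial_iff_nodup {f : Formula} :
    HasMultilinearMonomial f ↔
      ∃ ts : List Term, List.Forall₂ (fun T F => T ∈ F) ts f ∧ ts.flatten.Nodup := by
  constructor
  · rintro ⟨d, hd, hm⟩
    obtain ⟨ts, hts, rfl⟩ := mem_expansion.1 hd
    exact ⟨ts, hts, isMultilinear_exponent.1 hm⟩
  · rintro ⟨ts, hts, hn⟩
    exact ⟨_, mem_expansion.2 ⟨ts, hts, rfl⟩, isMultilinear_exponent.2 hn⟩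

/-- The terms of a clause, indexed by all numbers: out of range, it is the first term (and the
empty term if there is none). -/
def clauseItem (F : Clause) (j : ℕ) : Term := F.getD j (F.getD 0 [])

/-- The terms of a product of clauses with at most three terms each, indexed by all numbers. -/
def item (f : Formula) (p : ℕ) : Term := clauseItem (f.getD (p / 3) []) (p % 3)

/-- The terms number `p` and `q` have a common variable, or one of them is not multilinear. -/
def Conflict (f : Formula) (n p q : ℕ) : Prop :=
  p < n ∧ q < n ∧ p ≠ q ∧ ¬ (item f p ++ item f q).Nodup

theorem Conflict.symm {f : Formula} {n p q : ℕ} (h : Conflict f n p q) : Conflict f n q p :=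
  ⟨h.2.1, h.1, h.2.2.1.symm, fun h' => h.2.2.2 (List.nodup_append_comm.1 h')⟩

theorem item_eq {f : Formula} {i j : ℕ} (hj : j < 3) :
    item f (3 * i + j) = clauseItem (f.getD i []) j := by
  rw [item]
  congr 2
  · omega
  · omega

theorem item_of_le {f : Formula} {p : ℕ} (h : 3 * f.length ≤ p) : item f p = [] := by
  rw [item, List.getD_eq_default _ _ (show f.length ≤ p / 3 by omega)]
  simp [clauseItem]

theorem clauseItem_mem {F : Clause} (h : 1 ≤ F.length) (j : ℕ) : clauseItem F j ∈ F := by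
  rw [clauseItem]
  by_cases hj : j < F.length
  · rw [List.getD_eq_getElem _ _ hj]; exact List.getElem_mem _
  · rw [List.getD_eq_default _ _ (by omega), List.getD_eq_getElem _ _ h]; exact List.getElem_mem _

theorem exists_clauseItem_eq {F : Clause} {T : Term} (h : F.length ≤ 3) (hT : T ∈ F) :
    ∃ j < 3, clauseItem F j = T := by
  obtain ⟨j, hj, rfl⟩ := List.getElem_of_mem hT
  exact ⟨j, by omega, by rw [clauseItem, List.getD_eq_getElem _ _ hj]⟩

/-- Choices of terms correspond to selections of items; padding clauses from `m` to `L` contain only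
the empty term and conflict with nothing but non-squarefree terms. `Conflict` ignores the diagonal,
yet a non-squarefree term is excluded, because it conflicts with the permanent empty item `3 * L`.
-/
theorem hasMultilinearMonomial_iff_solvable {f : Formula} {m t L : ℕ} (hf : IsPiSigmaPi m 3 t f)
    (hL : m ≤ L) :
    HasMultilinearMonomial f ↔ Solvable L (Conflict f (3 * L + 1)) 0 := by
  have hm := hf.length_eq
  rw [hasMultilinearMonomial_iff_nodup]
  constructor
  · rintro ⟨ts, hts, hn⟩
    have hlen := hts.length_eq
    have hex : ∀ i, ∃ j < 3, ∀ h : i < ts.length, item f (3 * i + j) = ts[i] := by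
      intro i
      by_cases hi : i < ts.length
      · have hmem := List.forall₂_iff_get.1 hts |>.2 i hi (hlen ▸ hi)
        obtain ⟨j, hj, hjT⟩ := exists_clauseItem_eq
          (hf.terms_le _ (List.getElem_mem (hlen ▸ hi))) hmem
        refine ⟨j, hj, fun _ => ?_⟩
        rw [item_eq hj, List.getD_eq_getElem _ _ (hlen ▸ hi)]
        exact hjT
      · exact ⟨0, by norm_num, fun h => absurd h hi⟩
    choose c hc hct using hex
    refine ⟨c, hc, ?_⟩
    rw [List.nodup_flatten, List.pairwise_iff_getElem] at hn
    obtain ⟨hn₁, hn₂⟩ := hn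
    have hsingle : ∀ p ∈ selection L 0 c, (item f p).Nodup := by
      rintro p (rfl | ⟨i, -, hi, rfl⟩)
      · rw [item_of_le (by omega)]; exact List.nodup_nil
      · by_cases him : i < ts.length
        · rw [hct i him]; exact hn₁ _ (List.getElem_mem _)
        · rw [item_of_le (by omega)]; exact List.nodup_nil
    intro p hp q hq ⟨_, _, hpq, hcon⟩
    refine hcon (List.Nodup.append (hsingle p hp) (hsingle q hq) ?_)
    rcases hp with rfl | ⟨i, -, hi, rfl⟩
    · rw [item_of_le (by omega)]; simp
    by_cases him : i < ts.length
    swap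
    · rw [item_of_le (f := f) (p := 3 * i + c i) (by omega)]; simp
    rcases hq with rfl | ⟨i', -, hi', rfl⟩
    · rw [item_of_le (f := f) (p := 3 * L) (by omega)]; simp
    by_cases him' : i' < ts.length
    swap
    · rw [item_of_le (f := f) (p := 3 * i' + c i') (by omega)]; simp
    rw [hct i him, hct i' him']
    rcases lt_trichotomy i i' with h | rfl | h
    · exact hn₂ i i' him him' h
    · exact absurd rfl hpq
    · exact (hn₂ i' i him' him h).symm
  · rintro ⟨c, hc, hi⟩
    refine ⟨(List.range m).map fun i => item f (3 * i + c i), ?_, ?_⟩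
    · rw [List.forall₂_iff_get]
      refine ⟨by simp [hm], fun i h₁ h₂ => ?_⟩
      simp only [List.get_eq_getElem, List.getElem_map, List.getElem_range]
      rw [item_eq (hc i), List.getD_eq_getElem _ _ h₂]
      exact clauseItem_mem (hf.one_le_terms _ (List.getElem_mem _)) _
    · have hmem : ∀ i < m, 3 * i + c i ∈ selection L 0 c :=
        fun i hi => .inr ⟨i, Nat.zero_le _, by omega, rfl⟩
      have hlt : ∀ i < m, 3 * i + c i < 3 * L + 1 := fun i hi => by have := hc i; omega
      rw [List.nodup_flatten]
      constructor
      · intro T hT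
        simp only [List.mem_map, List.mem_range] at hT
        obtain ⟨i, him, rfl⟩ := hT
        -- Independence from the empty item says that the term itself is squarefree.
        have := hi _ (hmem i him) (3 * L) (.inl rfl)
        by_contra hcon
        refine this ⟨hlt i him, by omega, by have := hc i; omega, fun h => hcon ?_⟩
        exact (List.nodup_append.1 h).1
      · rw [List.pairwise_map]
        refine List.Pairwise.imp_of_mem ?_ (List.pairwise_lt_range (n := m))
        intro i i' h₁ h₂ hlt'
        rw [List.mem_range] at h₁ h₂
        have := hi _ (hmem i h₁) _ (hmem i' h₂)
        by_contra hcon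
        refine this ⟨hlt i h₁, hlt i' h₂, by have := hc i; omega, fun h => hcon ?_⟩
        exact List.disjoint_of_nodup_append h

/-- There is no cancellation over the integers. -/
theorem hasMultilinearMonomial_iff_support (f : Formula) :
    HasMultilinearMonomial f ↔ ∃ d ∈ (Formula.toPoly ℤ f).support, IsMultilinear d := by
  -- Each coefficient is a multiplicity in the expansion, so in characteristic zero it vanishes only
  -- if the monomial is absent.
  have hcoeff : ∀ d, MvPolynomial.coeff d (Formula.toPoly ℤ f) = (Formula.expansion f).count d := by
    intro d
    rw [Formula.toPoly_eq_sum_expansion]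
    induction Formula.expansion f with
    | nil => simp
    | cons e l ih =>
      simp only [List.map_cons, List.sum_cons, MvPolynomial.coeff_add, ih,
        MvPolynomial.coeff_monomial, List.count_cons]
      by_cases h : e = d <;> simp [h, add_comm]
  have hmem : ∀ d, d ∈ (Formula.toPoly ℤ f).support ↔ d ∈ Formula.expansion f := by
    intro d
    rw [MvPolynomial.mem_support_iff, hcoeff, Nat.cast_ne_zero, ← Nat.pos_iff_ne_zero,
      List.count_pos_iff]
  simp only [HasMultilinearMonomial, hmem]

/-! ### Matrices in the memory -/

/-- The matrix with rows of length `n` stored from the address `A` on, read as a relation. -/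
def matrix (A n : ℕ) (M : ℕ → ℕ) (p q : ℕ) : Prop := p < n ∧ q < n ∧ M (A + q + n * p) ≠ 0

theorem entry_lt {n p q : ℕ} (hp : p < n) (hq : q < n) : q + n * p < n * n := by
  calc q + n * p < n + n * p := by omega
    _ = n * (p + 1) := by ring
    _ ≤ n * n := Nat.mul_le_mul_left _ hp

theorem entry_inj {n p q p' q' : ℕ} (hq : q < n) (hq' : q' < n)
    (h : q + n * p = q' + n * p') : p = p' ∧ q = q' := by
  have h₁ : p = p' := by
    have := congrArg (· / n) h
    simpa [Nat.add_mul_div_left _ _ (show 0 < n by omega), Nat.div_eq_of_lt, hq, hq'] using this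
  subst h₁
  exact ⟨rfl, by omega⟩

theorem matrix_update {A n v p₀ q₀ : ℕ} {M : ℕ → ℕ} (hp₀ : p₀ < n) (hq₀ : q₀ < n) (p q : ℕ) :
    matrix A n (Function.update M (A + q₀ + n * p₀) v) p q ↔
      if p = p₀ ∧ q = q₀ then v ≠ 0 else matrix A n M p q := by
  unfold matrix
  split_ifs with h
  · obtain ⟨rfl, rfl⟩ := h
    simp [hp₀, hq₀]
  · constructor
    · rintro ⟨hp, hq, hM⟩
      refine ⟨hp, hq, ?_⟩
      rwa [Function.update_of_ne] at hM
      intro e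
      exact h (entry_inj hq hq₀ (by omega))
    · rintro ⟨hp, hq, hM⟩
      refine ⟨hp, hq, ?_⟩
      rwa [Function.update_of_ne]
      intro e
      exact h (entry_inj hq hq₀ (by omega))

theorem matrix_congr {A n p q : ℕ} {M M' : ℕ → ℕ} (h : ∀ x, A ≤ x → x < A + n * n → M x = M' x) :
    matrix A n M p q ↔ matrix A n M' p q := by
  unfold matrix
  refine and_congr_right fun hp => and_congr_right fun hq => ?_
  have := entry_lt hp hq
  rw [h _ (by omega) (by omega)]

/-! ### The elimination as a program -/

/-- Treats the pair of `R₂₄` and `R₂₃ - 1` in the elimination of the choice between `R₂₀` and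
`R₂₁` from the matrix at `R₇`. -/
def elimPair : Program :=
  .sub 25 23 9 ;;
  get 26 7 24 20 ;; get 27 7 20 20 ;; .add 26 26 27 ;;
  get 27 7 25 21 ;; get 28 7 21 21 ;; .add 27 27 28 ;;
  .ifNonzero 26 (.ifNonzero 27 (put 7 24 25 9 ;; put 7 25 24 9) skip) skip ;;
  .sub 23 23 9

/-- At most six matrix accesses, each of cost at most `3 * n + 7`, give the `18 * n`. Symmetry is
preserved because both entries of the pair are set. -/
theorem elimPair_spec {A n : ℕ} (σ : State) (h4 : σ.reg 4 = n) (h7 : σ.reg 7 = A)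
    (h9 : σ.reg 9 = 1) (h20 : σ.reg 20 < n) (h21 : σ.reg 21 < n) (h24 : σ.reg 24 < n)
    (h23 : σ.reg 23 - 1 < n) :
    wp elimPair (fun T τ => T ≤ 18 * n + 60 ∧ τ.reg 23 = σ.reg 23 - 1 ∧
      (∀ r < 25, r ≠ 23 → τ.reg r = σ.reg r) ∧ (∀ x < A, τ.mem x = σ.mem x) ∧
      ∀ p q, matrix A n τ.mem p q ↔ matrix A n σ.mem p q ∨
        ((matrix A n σ.mem (σ.reg 24) (σ.reg 20) ∨ matrix A n σ.mem (σ.reg 20) (σ.reg 20)) ∧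
          (matrix A n σ.mem (σ.reg 23 - 1) (σ.reg 21) ∨
            matrix A n σ.mem (σ.reg 21) (σ.reg 21))) ∧
        (p = σ.reg 24 ∧ q = σ.reg 23 - 1 ∨ p = σ.reg 23 - 1 ∧ q = σ.reg 24)) σ := by
  simp only [elimPair, wp_seq, wp_sub, h9]
  refine wp_get (by omega) (by omega) (by omega) ?_ ?_
  · simp (disch := omega) only [setReg_reg_ne, h9]
  simp (disch := omega) only [setReg_reg_ne, setReg_reg_self, setReg_mem, h4, h7]
  intro T₁ σ₁ hT₁ hd₁ hr₁ hm₁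
  refine wp_get (by omega) (by omega) (by omega) ?_ ?_
  · simp (disch := omega) only [hr₁, setReg_reg_ne, h9]
  simp (disch := omega) only [hr₁, setReg_reg_ne, setReg_reg_self, hm₁, h4, h7]
  intro T₂ σ₂ hT₂ hd₂ hr₂ hm₂
  rw [wp_add]
  simp (disch := omega) only [hr₂, hd₂, hd₁]
  refine wp_get (by omega) (by omega) (by omega) ?_ ?_
  · simp (disch := omega) only [hr₁, hr₂, setReg_reg_ne, h9]
  simp (disch := omega) only [hr₁, hr₂, setReg_reg_ne, setReg_reg_self, setReg_mem, hm₁, hm₂,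
    h4, h7]
  intro T₃ σ₃ hT₃ hd₃ hr₃ hm₃
  refine wp_get (by omega) (by omega) (by omega) ?_ ?_
  · simp (disch := omega) only [hr₁, hr₂, hr₃, setReg_reg_ne, h9]
  simp (disch := omega) only [hr₁, hr₂, hr₃, setReg_reg_ne, hm₃, h4, h7]
  intro T₄ σ₄ hT₄ hd₄ hr₄ hm₄
  rw [wp_add]
  simp (disch := omega) only [hr₄, hd₃, hd₄]
  set M := σ.mem with hM
  set a := σ.reg 20
  set b := σ.reg 21
  set p := σ.reg 24
  set q := σ.reg 23 - 1 with hq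
  -- The disjunction of two entries is computed as their sum, which is nonzero iff one of them is.
  set x := M (A + a + n * p) + M (A + a + n * a) with hx
  set y := M (A + b + n * q) + M (A + b + n * b) with hy
  have hx' : x ≠ 0 ↔ matrix A n M p a ∨ matrix A n M a a := by
    simp only [matrix, h20, h24, true_and]; omega
  have hy' : y ≠ 0 ↔ matrix A n M q b ∨ matrix A n M b b := by
    simp only [matrix, h21, h23, true_and]; omega
  have e26 : (σ₄.setReg 27 y).reg 26 = x := by
    simp (disch := omega) only [hr₃, hr₄, setReg_reg_ne, setReg_reg_self]
  rw [← hx', ← hy']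
  have hskip : ¬ (x ≠ 0 ∧ y ≠ 0) → ∀ p' q', matrix A n M p' q' ↔ matrix A n M p' q' ∨
      (x ≠ 0 ∧ y ≠ 0) ∧ (p' = p ∧ q' = q ∨ p' = q ∧ q' = p) := by
    intro h p' q'
    simp [h]
  have := Nat.mul_le_mul_left 3 h20.le
  by_cases hx0 : x = 0
  · refine wp_if_neg (by rw [e26, hx0]) ?_
    rw [skip, wp_const]
    simp (disch := omega) only [wp_sub, hr₁, hr₂, hr₃, hr₄, setReg_reg_ne, setReg_reg_self,
      setReg_mem, hm₄, hm₃, h9]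
    refine ⟨by omega, rfl, ?_, fun _ _ => trivial, hskip (by tauto)⟩
    intro r h₁ h₂
    simp (disch := omega) only [hr₁, hr₂, hr₃, hr₄, setReg_reg_ne]
  refine wp_if_pos (by rwa [e26]) ?_
  by_cases hy0 : y = 0
  · refine wp_if_neg (by rw [setReg_reg_self, hy0]) ?_
    rw [skip, wp_const]
    simp (disch := omega) only [wp_sub, hr₁, hr₂, hr₃, hr₄, setReg_reg_ne, setReg_reg_self,
      setReg_mem, hm₄, hm₃, h9]
    refine ⟨by omega, rfl, ?_, fun _ _ => trivial, hskip (by tauto)⟩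
    intro r h₁ h₂
    simp (disch := omega) only [hr₁, hr₂, hr₃, hr₄, setReg_reg_ne]
  refine wp_if_pos (by rwa [setReg_reg_self]) ?_
  rw [wp_seq]
  refine wp_put (by omega) (by omega) (by omega) (by omega) ?_ ?_
  · simp (disch := omega) only [hr₁, hr₂, hr₃, hr₄, setReg_reg_ne, h9]
  simp (disch := omega) only [hr₁, hr₂, hr₃, hr₄, setReg_reg_ne, setReg_reg_self, setReg_mem, hm₄,
    hm₃, h4, h7, h9]
  intro T₅ σ₅ hT₅ hr₅ hm₅
  refine wp_put (by omega) (by omega) (by omega) (by omega) ?_ ?_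
  · simp (disch := omega) only [hr₁, hr₂, hr₃, hr₄, hr₅, setReg_reg_ne, h9]
  simp (disch := omega) only [hr₁, hr₂, hr₃, hr₄, hr₅, setReg_reg_ne, setReg_reg_self, hm₅,
    h4, h7, h9]
  intro T₆ σ₆ hT₆ hr₆ hm₆
  simp (disch := omega) only [wp_sub, hr₁, hr₂, hr₃, hr₄, hr₅, hr₆, setReg_reg_ne,
    setReg_reg_self, setReg_mem, hm₆, h9]
  refine ⟨by omega, rfl, ?_, ?_, ?_⟩
  · intro r h₁ h₂
    simp (disch := omega) only [hr₁, hr₂, hr₃, hr₄, hr₅, hr₆, setReg_reg_ne]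
  · intro z hz
    simp (disch := omega) only [Function.update_of_ne]
  · intro p' q'
    rw [matrix_update h23 h24, matrix_update h24 h23]
    split_ifs <;> simp_all

/-- Eliminates the choice between `R₂₀` and `R₂₁` from the matrix at `R₇`. -/
def elim : Program :=
  mov 22 4 ;;
  .whileNonzero 22
    (.sub 24 22 9 ;; mov 23 4 ;; .whileNonzero 23 elimPair ;; .sub 22 22 9)

theorem elim_spec {A n : ℕ} (σ : State) (h4 : σ.reg 4 = n) (h7 : σ.reg 7 = A)
    (h9 : σ.reg 9 = 1) (h20 : σ.reg 20 < n) (h21 : σ.reg 21 < n)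
    (hs : ∀ p q, matrix A n σ.mem p q → matrix A n σ.mem q p) :
    wp elim (fun T τ => T ≤ n * (n * (18 * n + 61) + 10) + 10 ∧
      (∀ r < 20, τ.reg r = σ.reg r) ∧ (∀ x < A, τ.mem x = σ.mem x) ∧
      Elim n (matrix A n σ.mem) (σ.reg 20) (σ.reg 21) (fun _ _ => True) (matrix A n τ.mem)) σ := by
  rw [elim, wp_seq]
  refine wp_mov (by omega) ?_
  -- Rows are treated from the last one down, so with `i` rounds to come the finished rows are those
  -- with `i ≤ p`; the inner loop does the same with the columns of row `i`.
  refine (wp_while (fun i τ => τ.reg 22 = i ∧ i ≤ n ∧ (∀ r < 22, τ.reg r = σ.reg r) ∧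
    (∀ x < A, τ.mem x = σ.mem x) ∧ Elim n (matrix A n σ.mem) (σ.reg 20) (σ.reg 21)
      (fun p _ => i ≤ p) (matrix A n τ.mem)) (n * (18 * n + 60 + 1) + 8) (fun τ h => h.1) ?_ n _ ?_).mono ?_
  · rintro i τ ⟨h22, hi, hr, hm, he⟩
    refine ⟨by omega, ?_⟩
    simp only [wp_seq, wp_sub]
    refine wp_mov (by omega) ?_
    simp (disch := omega) only [setReg_reg_ne, setReg_reg_self, hr, h22, h9, h4]
    refine (wp_while (fun j τ' => τ'.reg 23 = j ∧ j ≤ n ∧ τ'.reg 24 = i ∧ τ'.reg 22 = i + 1 ∧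
      (∀ r < 22, τ'.reg r = σ.reg r) ∧ (∀ x < A, τ'.mem x = σ.mem x) ∧
      Elim n (matrix A n σ.mem) (σ.reg 20) (σ.reg 21)
      (fun p q => i + 1 ≤ p ∨ p = i ∧ j ≤ q) (matrix A n τ'.mem)) (18 * n + 60) (fun τ h => h.1)
      ?_ n _ ?_).mono ?_
    · rintro j υ ⟨h23, hj, h24, h22', hr', hm', he'⟩
      refine ⟨by omega, ?_⟩
      refine (elimPair_spec (A := A) (n := n) υ ?_ ?_ ?_ ?_ ?_ ?_ ?_).mono ?_ <;>
        simp (disch := omega) only [hr', h4, h7, h9, h20, h21, h24, h23]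
      · omega
      · omega
      rintro T υ' ⟨hT, h23', hr'', hm'', hD⟩
      refine ⟨hT, by omega, by omega, ?_, ?_, ?_, ?_, ?_⟩
      · rw [hr'' _ (by omega) (by omega), h24]
      · rw [hr'' _ (by omega) (by omega), h22']
      · intro r hlt
        rw [hr'' _ (by omega) (by omega), hr' _ hlt]
      · intro x hx
        rw [hm'' x hx, hm' x hx]
      · refine (he'.step hD).congr_done ?_
        intro p q _ _ h
        omega
    · simp (disch := omega) only [setReg_reg_ne, setReg_reg_self, setReg_mem, h22]
      refine ⟨trivial, le_rfl, by omega, trivial, ?_, hm, ?_⟩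
      · intro r hlt
        simp (disch := omega) only [setReg_reg_ne, hr]
      · refine he.congr_done ?_
        intro p q _ _ h
        omega
    · rintro T υ ⟨hT, h23, -, h24, h22', hr', hm', he'⟩
      simp (disch := omega) only [setReg_reg_ne, setReg_reg_self, setReg_mem, h22', hr', h9]
      refine ⟨by omega, by omega, by omega, ?_, hm', ?_⟩
      · intro r hlt
        simp (disch := omega) only [setReg_reg_ne, hr']
      · refine he'.congr_done ?_
        intro p q _ _ h
        omega
  · simp (disch := omega) only [setReg_reg_ne, setReg_reg_self, setReg_mem, h4]
    refine ⟨trivial, le_rfl, ?_, fun _ _ => trivial, ?_⟩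
    · intro r hlt
      simp (disch := omega) only [setReg_reg_ne]
    · refine Elim.refl _ _ hs ?_
      intro p q _ _
      omega
  · rintro T τ ⟨hT, -, -, hr, hm, he⟩
    refine ⟨?_, fun r hlt => hr r (by omega), hm, he.congr_done ?_⟩
    · rw [show n * (18 * n + 60 + 1) + 8 + 1 = n * (18 * n + 61) + 9 from rfl] at hT
      have : n * (n * (18 * n + 61) + 9) ≤ n * (n * (18 * n + 61) + 10) :=
        Nat.mul_le_mul_left _ (by omega)
      omega
    · intro p q _ _ _
      omega

/-! ### The search -/

/-- If `R₁₁ ≥ R₂`, subtract `R₂` from `R₁₁` and add `1` to `R₁₄`. -/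
def reduce : Program :=
  .add 15 11 9 ;; .sub 15 15 2 ;; .ifNonzero 15 (.sub 11 11 2 ;; .add 14 14 9) skip

/-- The truncated difference `R₁₁ + 1 - R₂` is nonzero exactly when `R₂ ≤ R₁₁`. -/
theorem reduce_spec (σ : State) (h9 : σ.reg 9 = 1) :
    wp reduce (fun T τ => T ≤ 5 ∧ (σ.reg 11 < σ.reg 2 → τ.reg 11 = σ.reg 11 ∧ τ.reg 14 = σ.reg 14) ∧
      (σ.reg 2 ≤ σ.reg 11 → τ.reg 11 = σ.reg 11 - σ.reg 2 ∧ τ.reg 14 = σ.reg 14 + 1) ∧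
      (∀ r < 14, r ≠ 11 → τ.reg r = σ.reg r) ∧ τ.mem = σ.mem) σ := by
  simp only [reduce, wp_seq, wp_add, wp_sub]
  simp (disch := omega) only [setReg_reg_ne, setReg_reg_self, h9]
  by_cases h : σ.reg 2 ≤ σ.reg 11
  · refine wp_if_pos ?_ ?_
    · rw [setReg_reg_self]; omega
    · simp (disch := omega) only [wp_seq, wp_sub, wp_add, setReg_reg_ne, setReg_reg_self,
        setReg_mem, h9]
      refine ⟨by omega, by omega, by simp, fun r h₁ h₂ => ?_, trivial⟩
      simp (disch := omega) only [setReg_reg_ne]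
  · refine wp_if_neg ?_ ?_
    · rw [setReg_reg_self]; omega
    · rw [skip, wp_const]
      simp (disch := omega) only [setReg_reg_ne, setReg_reg_self, setReg_mem]
      refine ⟨by omega, by simp, by omega, fun r h₁ h₂ => ?_, trivial⟩
      simp (disch := omega) only [setReg_reg_ne]

/-- `R₁₄ := 3 R₁₁ / R₂`, `R₁₁ := 3 R₁₁ % R₂` -/
def nextDigit : Program :=
  .add 14 11 11 ;; .add 11 14 11 ;; .const 14 0 ;; reduce ;; reduce

/-- From `R₁₁ < R₂` one gets `3 * R₁₁ < 3 * R₂`, so two conditional subtractions yield quotient and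
remainder. Producing the leading digit first avoids any division by `3`. -/
theorem nextDigit_spec (σ : State) (h9 : σ.reg 9 = 1) (hlt : σ.reg 11 < σ.reg 2) :
    wp nextDigit (fun T τ => T ≤ 13 ∧ τ.reg 11 = 3 * σ.reg 11 % σ.reg 2 ∧
      τ.reg 14 = 3 * σ.reg 11 / σ.reg 2 ∧
      (∀ r < 14, r ≠ 11 → τ.reg r = σ.reg r) ∧ τ.mem = σ.mem) σ := by
  simp only [nextDigit, wp_seq, wp_add, wp_const]
  simp (disch := omega) only [setReg_reg_ne, setReg_reg_self]
  refine (reduce_spec _ ?_).mono ?_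
  · simp (disch := omega) only [setReg_reg_ne, h9]
  simp (disch := omega) only [setReg_reg_ne, setReg_reg_self, setReg_mem]
  rintro T₁ σ₁ ⟨hT₁, ha₁, hb₁, hr₁, hm₁⟩
  refine (reduce_spec _ ?_).mono ?_
  · simp (disch := omega) only [hr₁, setReg_reg_ne, h9]
  simp (disch := omega) only [setReg_reg_ne, setReg_reg_self, setReg_mem, hr₁]
  rintro T₂ σ₂ ⟨hT₂, ha₂, hb₂, hr₂, hm₂⟩
  have h := (Nat.div_mod_unique (a := 3 * σ.reg 11) (b := σ.reg 2) (c := σ₂.reg 11)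
    (d := σ₂.reg 14) (by omega)).2 (by
      rcases lt_or_ge (σ₁.reg 11) (σ.reg 2) with h₂ | h₂
      · obtain ⟨e₁, e₂⟩ := ha₂ h₂
        rw [e₁, e₂]
        refine ⟨?_, h₂⟩
        rcases lt_or_ge (σ.reg 11 + σ.reg 11 + σ.reg 11) (σ.reg 2) with h₁ | h₁
        · obtain ⟨e₃, e₄⟩ := ha₁ h₁
          rw [e₃, e₄]; omega
        · obtain ⟨e₃, e₄⟩ := hb₁ h₁
          rw [e₃, e₄]; omega
      · obtain ⟨e₁, e₂⟩ := hb₂ h₂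
        rw [e₁, e₂]
        rcases lt_or_ge (σ.reg 11 + σ.reg 11 + σ.reg 11) (σ.reg 2) with h₁ | h₁
        · have := (ha₁ h₁).1
          omega
        · obtain ⟨e₃, e₄⟩ := hb₁ h₁
          rw [e₃] at h₂ ⊢
          rw [e₄]; omega)
  refine ⟨by omega, h.2.symm, h.1.symm, fun r h₁ h₂ => ?_, by rw [hm₂, hm₁]⟩
  rw [hr₂ r h₁ h₂, hr₁ r h₁ h₂]
  simp (disch := omega) only [setReg_reg_ne]

/-- Copies the matrix at `R₆` to `R₇`, which is just behind it. -/
def copyMatrix : Program :=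
  .sub 12 7 6 ;;
  .whileNonzero 12
    (.sub 12 12 9 ;; .add 13 6 12 ;; .load 14 13 ;; .add 13 7 12 ;; .store 13 14)

theorem copyMatrix_spec {A N : ℕ} (σ : State) (h6 : σ.reg 6 = A) (h7 : σ.reg 7 = A + N)
    (h9 : σ.reg 9 = 1) :
    wp copyMatrix (fun T τ => T ≤ N * 6 + 2 ∧ (∀ r < 12, τ.reg r = σ.reg r) ∧
      (∀ x < A + N, τ.mem x = σ.mem x) ∧ ∀ x < N, τ.mem (A + N + x) = σ.mem (A + x)) σ := by
  simp only [copyMatrix, wp_seq, wp_sub]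
  refine (wp_while (fun i τ => τ.reg 12 = i ∧ i ≤ N ∧ (∀ r < 12, τ.reg r = σ.reg r) ∧
    (∀ x < A + N, τ.mem x = σ.mem x) ∧ ∀ x < N, i ≤ x → τ.mem (A + N + x) = σ.mem (A + x))
    5 (fun τ h => h.1) ?_ N _ ?_).mono ?_
  · rintro i τ ⟨h12, hi, hr, hm, hc⟩
    refine ⟨by omega, ?_⟩
    simp (disch := omega) only [wp_seq, wp_add, wp_sub, wp_load, wp_store, setReg_reg_ne,
      setReg_reg_self, setReg_mem, setMem_reg, setMem_mem, hr, h12, h6, h7, h9]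
    refine ⟨le_rfl, by omega, by omega, ?_, ?_, ?_⟩
    · intro r hlt
      simp (disch := omega) only [setReg_reg_ne, hr]
    · intro x hx
      rw [Function.update_of_ne (by omega), hm x hx]
    · intro x hx hix
      by_cases hxi : x = i
      · subst hxi
        rw [show x + 1 - 1 = x by omega, Function.update_self, hm _ (by omega)]
      · rw [Function.update_of_ne (by omega), hc x hx (by omega)]
  · simp (disch := omega) only [setReg_reg_ne, setReg_reg_self, setReg_mem]
    refine ⟨by omega, le_rfl, ?_, fun _ _ => trivial, by omega⟩
    intro r hlt
    simp (disch := omega) only [setReg_reg_ne]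
  · rintro T τ ⟨hT, -, -, hr, hm, hc⟩
    exact ⟨by omega, hr, hm, fun x hx => hc x hx (Nat.zero_le _)⟩

/-- Removes the term whose number is the next digit from the clauses `R₁₃ / 3` and `R₁₃ / 3 + 1`,
and eliminates these two clauses. -/
def eliminateTwo : Program :=
  nextDigit ;;
  .sub 16 9 14 ;; .const 17 2 ;; .sub 18 14 9 ;; .sub 17 17 18 ;; .const 18 3 ;;
  .add 20 13 16 ;; .add 21 13 17 ;; elim ;; .add 13 13 18 ;;
  .add 20 13 16 ;; .add 21 13 17 ;; elim ;; .add 13 13 18 ;;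
  .sub 12 12 9

/-- A bound for the time of `elim`. -/
def elimTime (n : ℕ) : ℕ := n * (n * (18 * n + 61) + 10) + 10

theorem eliminateTwo_spec {A n j : ℕ} (σ : State) (h4 : σ.reg 4 = n) (h7 : σ.reg 7 = A)
    (h9 : σ.reg 9 = 1) (hlt : σ.reg 11 < σ.reg 2) (h13 : σ.reg 13 = 3 * j) (hj : 3 * j + 6 ≤ n)
    (hs : ∀ p q, matrix A n σ.mem p q → matrix A n σ.mem q p) :
    wp eliminateTwo (fun T τ => T ≤ 2 * elimTime n + 26 ∧
      τ.reg 11 = 3 * σ.reg 11 % σ.reg 2 ∧ τ.reg 12 = σ.reg 12 - 1 ∧ τ.reg 13 = 3 * (j + 2) ∧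
      (∀ r < 11, τ.reg r = σ.reg r) ∧ (∀ x < A, τ.mem x = σ.mem x) ∧
      ∃ D' x y, x < 3 ∧ y < 3 ∧ (∀ c < 3, c ≠ 3 * σ.reg 11 / σ.reg 2 → c = x ∨ c = y) ∧
        Elim n (matrix A n σ.mem) (3 * j + x) (3 * j + y) (fun _ _ => True) D' ∧
        Elim n D' (3 * (j + 1) + x) (3 * (j + 1) + y) (fun _ _ => True) (matrix A n τ.mem)) σ := by
  rw [eliminateTwo, wp_seq]
  refine (nextDigit_spec σ h9 hlt).mono ?_
  rintro T₁ σ₁ ⟨hT₁, h11, h14, hr₁, hm₁⟩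
  simp (disch := omega) only [wp_seq, wp_sub, wp_const, wp_add, setReg_reg_ne, setReg_reg_self,
    hr₁, h9, h13]
  set d := 3 * σ.reg 11 / σ.reg 2 with hd
  have hd3 : d < 3 := by
    rw [hd, Nat.div_lt_iff_lt_mul (by omega)]; omega
  rw [h14]
  refine (elim_spec (A := A) (n := n) _ ?_ ?_ ?_ ?_ ?_ ?_).mono ?_ <;>
    simp (disch := omega) only [setReg_reg_ne, setReg_reg_self, setReg_mem, hr₁, hm₁, h4, h7, h9]
  · omega
  · omega
  · exact hs
  rintro T₂ σ₂ ⟨hT₂, hr₂, hm₂, he₂⟩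
  simp (disch := omega) only [wp_seq, wp_sub, wp_const, wp_add, setReg_reg_ne, setReg_reg_self,
    hr₁, hr₂, h9, h13]
  refine (elim_spec (A := A) (n := n) _ ?_ ?_ ?_ ?_ ?_ ?_).mono ?_ <;>
    simp (disch := omega) only [setReg_reg_ne, setReg_reg_self, setReg_mem, hr₁, hr₂, hm₁, h4, h7,
      h9]
  · omega
  · omega
  · exact he₂.symm
  rintro T₃ σ₃ ⟨hT₃, hr₃, hm₃, he₃⟩
  simp (disch := omega) only [wp_seq, wp_sub, wp_const, wp_add, setReg_reg_ne, setReg_reg_self,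
    setReg_mem, hr₁, hr₂, hr₃, h9, h13]
  rw [elimTime]
  -- In truncated subtraction, `1 - d` and `2 - (d - 1)` are the two numbers below `3` other than
  -- `d`.
  refine ⟨by omega, h11, trivial, by ring, ?_, ?_, _, 1 - d, 2 - (d - 1), by omega, by omega,
    by omega, he₂, ?_⟩
  · intro r hlt
    simp (disch := omega) only [setReg_reg_ne, hr₁, hr₂, hr₃]
  · intro x hx
    rw [hm₃ x hx, hm₂ x hx]
  · exact he₃

/-- One round of the search: with the digits of `R₁₀ - 1`. -/
def tryDigits : Program :=
  .sub 10 10 9 ;; mov 11 10 ;; copyMatrix ;; .const 13 0 ;; mov 12 3 ;;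
  .whileNonzero 12 eliminateTwo ;;
  .sub 16 4 9 ;; get 17 7 16 16 ;; .ifNonzero 17 skip (.const 0 1)

/-- The digits of `r` remove no item of some solution. -/
def Compatible (k : ℕ) (D : ℕ → ℕ → Prop) (r : ℕ) : Prop :=
  ∃ c : ℕ → ℕ, (∀ i, c i < 3) ∧
    (∀ l < k, c (2 * l) ≠ digit (3 ^ k) r l ∧ c (2 * l + 1) ≠ digit (3 ^ k) r l) ∧
    Indep D (selection (2 * k) 0 c)

/-- Pigeonhole: the two choices in a pair of clauses miss at least one of the three digits. -/
theorem exists_compatible {k : ℕ} {D : ℕ → ℕ → Prop} (h : Solvable (2 * k) D 0) :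
    ∃ r < 3 ^ k, Compatible k D r := by
  obtain ⟨c, hc, hi⟩ := h
  have hex : ∀ l, ∃ d < 3, c (2 * l) ≠ d ∧ c (2 * l + 1) ≠ d := by
    intro l
    by_contra! hcon
    have h0 := hcon 0 (by omega)
    have h1 := hcon 1 (by omega)
    have h2 := hcon 2 (by omega)
    omega
  choose δ hδ hne using hex
  obtain ⟨r, hr, hd⟩ := exists_digit_eq k δ hδ
  exact ⟨r, hr, c, hc, fun l hl => by rw [hd l hl]; exact hne l, hi⟩

/-- The two outcomes are deliberately not complementary. Acceptance proves solvability outright,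
since restricting the choices creates no solutions; rejection only rules out the solutions
compatible with these digits. -/
theorem tryDigits_spec {A n k i : ℕ} (σ : State) (h2 : σ.reg 2 = 3 ^ k) (h3 : σ.reg 3 = k)
    (h4 : σ.reg 4 = n) (h6 : σ.reg 6 = A) (h7 : σ.reg 7 = A + n * n)
    (h9 : σ.reg 9 = 1) (h10 : σ.reg 10 = i + 1) (hi : i < 3 ^ k) (hn : n = 3 * (2 * k) + 1)
    (hs : ∀ p q, matrix A n σ.mem p q → matrix A n σ.mem q p) :
    wp tryDigits (fun T τ => T ≤ n * n * 6 + k * (2 * elimTime n + 26 + 1) + 3 * n + 30 ∧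
      τ.reg 10 = i ∧ (∀ r < 10, r ≠ 0 → τ.reg r = σ.reg r) ∧
      (∀ x < A + n * n, τ.mem x = σ.mem x) ∧
      (τ.reg 0 = 1 ∧ Solvable (2 * k) (matrix A n σ.mem) 0 ∨
        τ.reg 0 = σ.reg 0 ∧ ¬ Compatible k (matrix A n σ.mem) i)) σ := by
  simp only [tryDigits, wp_seq, wp_sub]
  refine wp_mov (by omega) ?_
  simp (disch := omega) only [setReg_reg_self, h9, h10]
  refine (copyMatrix_spec (A := A) (N := n * n) _ ?_ ?_ ?_).mono ?_ <;>
    simp (disch := omega) only [setReg_reg_ne, setReg_reg_self, setReg_mem, h6, h7, h9]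
  rintro T₁ σ₁ ⟨hT₁, hr₁, hm₁, hc₁⟩
  rw [wp_const]
  refine wp_mov (by omega) ?_
  simp (disch := omega) only [setReg_reg_ne, hr₁, h3]
  have hD₁ : matrix (A + n * n) n σ₁.mem = matrix A n σ.mem := by
    funext p q
    refine propext (and_congr_right fun hp => and_congr_right fun hq => ?_)
    rw [add_assoc _ q, hc₁ _ (entry_lt hp hq), ← add_assoc]
  -- The invariant carries both directions: solvability of the rest lifts back to the whole system,
  -- and a solution that avoids the digits stays independent.
  refine (wp_while (fun j τ => j ≤ k ∧ τ.reg 12 = j ∧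
    τ.reg 11 = remainder (3 ^ k) i (k - j) ∧ τ.reg 13 = 3 * (2 * (k - j)) ∧ τ.reg 10 = i ∧
    (∀ r < 10, τ.reg r = σ.reg r) ∧ (∀ x < A + n * n, τ.mem x = σ.mem x) ∧
    (∀ p q, matrix (A + n * n) n τ.mem p q → matrix (A + n * n) n τ.mem q p) ∧
    (Solvable (2 * k) (matrix (A + n * n) n τ.mem) (2 * (k - j)) →
      Solvable (2 * k) (matrix A n σ.mem) 0) ∧
    ∀ c : ℕ → ℕ, (∀ i, c i < 3) →
      (∀ l < k, c (2 * l) ≠ digit (3 ^ k) i l ∧ c (2 * l + 1) ≠ digit (3 ^ k) i l) →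
      Indep (matrix A n σ.mem) (selection (2 * k) 0 c) →
      Indep (matrix (A + n * n) n τ.mem) (selection (2 * k) 0 c))
    (2 * elimTime n + 26) (fun τ h => h.2.1) ?_ k _ ?_).mono ?_
  · rintro j τ ⟨hj, h12, h11, h13, h10', hr, hm, hs', hsolv, hindep⟩
    refine ⟨by omega, ?_⟩
    have hrem := remainder_lt hi (k - (j + 1))
    have hl : k - j = k - (j + 1) + 1 := by omega
    have hlk : k - (j + 1) < k := by omega
    generalize k - (j + 1) = l at *
    refine (eliminateTwo_spec (A := A + n * n) (n := n) (j := 2 * l) τ ?_ ?_ ?_ ?_ h13 ?_ hs').mono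
      ?_
    · rw [hr 4 (by omega), h4]
    · rw [hr 7 (by omega), h7]
    · rw [hr 9 (by omega), h9]
    · rwa [h11, hr 2 (by omega), h2]
    · omega
    rw [h11, hr 2 (by omega), h2]
    rintro T υ ⟨hT, h11'', h12'', h13'', hr'', hm'', D', x, y, hx, hy, hxy, he, he'⟩
    rw [hl]
    refine ⟨hT, by omega, by omega, h11'', by rw [h13'']; ring, by rw [hr'' _ (by omega), h10'],
      ?_, ?_, he'.symm, ?_, ?_⟩
    · intro r hlt
      rw [hr'' r (by omega), hr r hlt]
    · intro z hz
      rw [hm'' z hz, hm z hz]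
    -- Extension backwards through the two eliminations, the later one first; the digit is
    -- irrelevant here.
    · intro h
      rw [hn] at he he'
      exact hsolv (hn ▸ he.solvable (hn ▸ hs') hx hy (he'.solvable he.symm hx hy (by
        rw [hn] at h; exact h)))
    -- Here the digit matters: the choices in both clauses differ from it, so they are among the two
    -- items kept.
    · intro c hc hcd hci
      rw [hn] at he he'
      have h := hindep c hc hcd hci
      rw [hn] at h ⊢
      exact he'.indep_selection (by omega) (hxy _ (hc _) (hcd l hlk).2)
        (he.indep_selection (by omega) (hxy _ (hc _) (hcd l hlk).1) h)
  · simp (disch := omega) only [setReg_reg_ne, setReg_reg_self, setReg_mem, hr₁, hD₁, Nat.sub_self]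
    refine ⟨le_rfl, trivial, ?_, trivial, by omega, ?_, hm₁, hs, fun h => h, fun c _ _ h => h⟩
    · exact Nat.add_sub_cancel i 1
    · intro r hlt
      simp (disch := omega) only [setReg_reg_ne, hr₁]
  · rintro T₂ σ₂ ⟨hT₂, -, -, -, -, h10', hr₂, hm₂, -, hsolv, hindep⟩
    refine wp_get (by omega) (by omega) (by omega) ?_ ?_
    · simp (disch := omega) only [setReg_reg_ne, hr₂, h9]
    simp (disch := omega) only [setReg_reg_ne, setReg_reg_self, setReg_mem, hr₂, h4, h7, h9]
    intro T₃ σ₃ hT₃ hd₃ hr₃ hm₃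
    have hend : σ₃.reg 17 ≠ 0 ↔
        matrix (A + n * n) n σ₂.mem (3 * (2 * k)) (3 * (2 * k)) := by
      have e : n - 1 = 3 * (2 * k) := by omega
      have hlt : 3 * (2 * k) < n := by omega
      rw [hd₃, e]
      simp [matrix, hlt]
    by_cases h17 : σ₃.reg 17 = 0
    · refine wp_if_neg h17 ?_
      simp (disch := omega) only [wp_const, setReg_reg_ne, setReg_reg_self, setReg_mem, hr₃, hm₃]
      refine ⟨by omega, h10', ?_, hm₂, .inl ⟨trivial, hsolv ?_⟩⟩
      · intro r h₁ h₂
        simp (disch := omega) only [setReg_reg_ne, hr₃, hr₂]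
      · rw [Nat.sub_zero, solvable_end_iff, ← hend]
        exact not_not.2 h17
    · refine wp_if_pos h17 ?_
      simp (disch := omega) only [skip, wp_const, setReg_reg_ne, setReg_reg_self, setReg_mem, hr₃,
        hr₂, hm₃]
      refine ⟨by omega, h10', ?_, hm₂, .inr ⟨trivial, ?_⟩⟩
      · intro r h₁ h₂
        simp (disch := omega) only [setReg_reg_ne, hr₃, hr₂]
      · rintro ⟨c, hc, hcd, hci⟩
        exact hindep c hc hcd hci _ (.inl rfl) _ (.inl rfl) (hend.1 h17)

/-- Tries all sequences of digits. -/
def search : Program := mov 10 2 ;; .whileNonzero 10 tryDigits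

theorem search_spec {A n k : ℕ} (σ : State) (h0 : σ.reg 0 = 0) (h2 : σ.reg 2 = 3 ^ k)
    (h3 : σ.reg 3 = k) (h4 : σ.reg 4 = n) (h6 : σ.reg 6 = A) (h7 : σ.reg 7 = A + n * n)
    (h9 : σ.reg 9 = 1) (hn : n = 3 * (2 * k) + 1)
    (hs : ∀ p q, matrix A n σ.mem p q → matrix A n σ.mem q p) :
    wp search (fun T τ =>
      T ≤ 3 ^ k * (n * n * 6 + k * (2 * elimTime n + 26 + 1) + 3 * n + 30 + 1) + 3 ∧
      (Solvable (2 * k) (matrix A n σ.mem) 0 → τ.reg 0 = 1) ∧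
      (¬ Solvable (2 * k) (matrix A n σ.mem) 0 → τ.reg 0 = 0)) σ := by
  rw [search, wp_seq]
  refine wp_mov (by omega) ?_
  rw [h2]
  refine (wp_while (fun i τ => i ≤ 3 ^ k ∧ τ.reg 10 = i ∧
    (∀ r < 10, r ≠ 0 → τ.reg r = σ.reg r) ∧ (∀ x < A + n * n, τ.mem x = σ.mem x) ∧
    (τ.reg 0 = 1 ∧ Solvable (2 * k) (matrix A n σ.mem) 0 ∨
      τ.reg 0 = 0 ∧ ∀ r < 3 ^ k, i ≤ r → ¬ Compatible k (matrix A n σ.mem) r))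
    (n * n * 6 + k * (2 * elimTime n + 26 + 1) + 3 * n + 30) (fun τ h => h.2.1) ?_ (3 ^ k) _ ?_).mono ?_
  · rintro i τ ⟨hi, h10, hr, hm, hd⟩
    refine ⟨by omega, ?_⟩
    have hD : matrix A n τ.mem = matrix A n σ.mem := by
      funext p q
      exact propext (matrix_congr fun x _ hx => hm x hx)
    refine (tryDigits_spec (A := A) (n := n) (k := k) (i := i) τ ?_ ?_ ?_ ?_ ?_ ?_ h10 hi hn
      ?_).mono ?_
    · rw [hr _ (by omega) (by omega), h2]
    · rw [hr _ (by omega) (by omega), h3]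
    · rw [hr _ (by omega) (by omega), h4]
    · rw [hr _ (by omega) (by omega), h6]
    · rw [hr _ (by omega) (by omega), h7]
    · rw [hr _ (by omega) (by omega), h9]
    · rwa [hD]
    rw [hD]
    rintro T υ ⟨hT, h10', hr', hm', hd'⟩
    refine ⟨hT, by omega, h10', ?_, ?_, ?_⟩
    · intro r h₁ h₂
      rw [hr' r h₁ h₂, hr r h₁ h₂]
    · intro x hx
      rw [hm' x hx, hm x hx]
    · rcases hd' with hd' | ⟨e, hd'⟩
      · exact .inl hd'
      rcases hd with hd | ⟨e', hd⟩
      · exact .inl ⟨e.trans hd.1, hd.2⟩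
      · refine .inr ⟨e.trans e', fun r hr hir => ?_⟩
        rcases hir.eq_or_lt with rfl | hlt
        · exact hd'
        · exact hd r hr hlt
  · simp (disch := omega) only [setReg_reg_ne, setReg_reg_self, setReg_mem]
    refine ⟨le_rfl, trivial, ?_, fun _ _ => trivial, .inr ⟨h0, by omega⟩⟩
    intro r h₁ h₂
    simp (disch := omega) only [setReg_reg_ne]
  · rintro T τ ⟨hT, -, -, -, -, hd⟩
    refine ⟨by omega, ?_, ?_⟩
    · intro h
      rcases hd with hd | ⟨-, hd⟩
      · exact hd.1
      -- A solvable system cannot have been rejected for every sequence of digits.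
      · obtain ⟨r, hr, hc⟩ := exists_compatible h
        exact absurd hc (hd r hr (Nat.zero_le _))
    · intro h
      rcases hd with hd | hd
      · exact absurd hd.2 h
      · exact hd.1

/-! ### The conflicts of the terms -/

/-- The list `l` stands in the memory from the address `a` on. -/
def Spells (M : ℕ → ℕ) : ℕ → List ℕ → Prop
  | _, [] => True
  | a, x :: l => M a = x ∧ Spells M (a + 1) l

theorem Spells.congr {M M' : ℕ → ℕ} {a : ℕ} {l : List ℕ} (h : Spells M a l)
    (hM : ∀ x, a ≤ x → x < a + l.length → M' x = M x) : Spells M' a l := by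
  induction l generalizing a with
  | nil => trivial
  | cons x l ih =>
    rw [List.length_cons] at hM
    exact ⟨(hM a le_rfl (by omega)).trans h.1, ih h.2 fun y h₁ h₂ => hM y (by omega) (by omega)⟩

theorem spells_append {M : ℕ → ℕ} {a : ℕ} {l l' : List ℕ} :
    Spells M a (l ++ l') ↔ Spells M a l ∧ Spells M (a + l.length) l' := by
  induction l generalizing a with
  | nil => simp [Spells]
  | cons x l ih =>
    rw [List.cons_append, Spells, ih, Spells, and_assoc, List.length_cons, add_right_comm a 1,
      add_assoc]

/-- The cells from `B` on hold at most `s`; those that hold `s` are the ones of the numbers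
in `L`. -/
def Marked (B s : ℕ) (L : List ℕ) (M : ℕ → ℕ) : Prop :=
  ∀ x, M (B + x) ≤ s ∧ (M (B + x) = s ↔ x ∈ L)

/-- Reads the term at the address `R₂₀`, marks its variables with `R₁₀` in the cells from `R₈` on,
and sets `R₁₁` to `1` if some variable was marked already. -/
def scan : Program :=
  .load 21 20 ;;
  .whileNonzero 21
    (.add 20 20 9 ;; .load 22 20 ;; .add 22 8 22 ;; .load 23 22 ;; .sub 23 10 23 ;;
      .ifNonzero 23 (.store 22 10) (.const 11 1) ;; .sub 21 21 9)

/-- With `s` the current stamp, `L` lists the variables already met. All marks are at most `s`, so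
`s` minus the mark is zero exactly at a variable seen before; this detects repetitions within the
term and across terms alike. -/
theorem scan_spec {B s : ℕ} {S L : List ℕ} (σ : State) (h8 : σ.reg 8 = B) (h9 : σ.reg 9 = 1)
    (h10 : σ.reg 10 = s) (hS : Spells σ.mem (σ.reg 20) (S.length :: S))
    (hB : σ.reg 20 + S.length < B) (hL : Marked B s L σ.mem) (h11 : σ.reg 11 = 0 ↔ L.Nodup) :
    wp scan (fun T τ => T ≤ 9 * S.length + 2 ∧ (∀ r < 20, r ≠ 11 → τ.reg r = σ.reg r) ∧
      (∀ x < B, τ.mem x = σ.mem x) ∧ Marked B s (S.reverse ++ L) τ.mem ∧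
      (τ.reg 11 = 0 ↔ (S.reverse ++ L).Nodup)) σ := by
  rw [scan, wp_seq, wp_load, hS.1]
  -- `R` is the unread rest of the term and `L'` the list of variables met so far, latest first.
  refine (wp_while (fun j τ => τ.reg 21 = j ∧ (∀ r < 20, r ≠ 11 → τ.reg r = σ.reg r) ∧
    (∀ x < B, τ.mem x = σ.mem x) ∧ ∃ R L', R.length = j ∧ Spells σ.mem (τ.reg 20 + 1) R ∧
      τ.reg 20 + j < B ∧ R.reverse ++ L' = S.reverse ++ L ∧ Marked B s L' τ.mem ∧
      (τ.reg 11 = 0 ↔ L'.Nodup)) 8 (fun τ h => h.1) ?_ S.length _ ?_).mono ?_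
  · rintro j τ ⟨h21, hr, hm, R, L', hR, hspell, hlt, hRL, hM, hf⟩
    refine ⟨by omega, ?_⟩
    obtain _ | ⟨x, R⟩ := R
    · simp at hR
    obtain ⟨hx, hspell⟩ := hspell
    rw [List.length_cons] at hR
    simp (disch := omega) only [wp_seq, wp_add, wp_load, wp_sub, setReg_reg_self, setReg_reg_ne,
      setReg_mem, hr, hm, hx, h8, h9, h10]
    obtain ⟨hMx, hMx'⟩ := hM x
    by_cases hxL : x ∈ L'
    · refine wp_if_neg ?_ ?_
      · rw [setReg_reg_self, hMx'.2 hxL, Nat.sub_self]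
      · simp (disch := omega) only [wp_const, wp_sub, setReg_reg_self, setReg_reg_ne,
          setReg_mem, hr, h21, h9]
        refine ⟨by omega, by omega, ?_, hm, R, x :: L', by omega, hspell, by omega, ?_, ?_, ?_⟩
        · intro r h₁ h₂
          simp (disch := omega) only [setReg_reg_ne, hr]
        · rw [← hRL]; simp
        · intro y
          obtain ⟨hy, hy'⟩ := hM y
          refine ⟨hy, hy'.trans ?_⟩
          rw [List.mem_cons]
          exact ⟨.inr, fun h => h.elim (fun e => e ▸ hxL) id⟩
        · simp [hxL]
    · refine wp_if_pos ?_ ?_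
      · rw [setReg_reg_self]
        have : τ.mem (B + x) ≠ s := fun h => hxL (hMx'.1 h)
        omega
      · simp (disch := omega) only [wp_store, wp_sub, setReg_reg_self, setReg_reg_ne,
          setReg_mem, setMem_reg, setMem_mem, hr, h21, h9, h10]
        refine ⟨by omega, by omega, ?_, ?_, R, x :: L', by omega, hspell, by omega, ?_, ?_, ?_⟩
        · intro r h₁ h₂
          simp (disch := omega) only [setMem_reg, setReg_reg_ne, hr]
        · intro y hy
          rw [Function.update_of_ne (by omega), hm y hy]
        · rw [← hRL]; simp
        · intro y
          by_cases hyx : y = x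
          · subst hyx; simp
          · rw [Function.update_of_ne (by omega), List.mem_cons]
            simpa [hyx] using hM y
        · simp [hxL, hf]
  · simp (disch := omega) only [setReg_reg_self, setReg_reg_ne, setReg_mem]
    refine ⟨trivial, ?_, fun _ _ => trivial, S, L, rfl, hS.2, hB, rfl, hL, h11⟩
    intro r h₁ h₂
    simp (disch := omega) only [setReg_reg_ne]
  · rintro T τ ⟨hT, -, hr, hm, R, L', hR, -, -, hRL, hM, hf⟩
    obtain rfl := List.length_eq_zero_iff.1 hR
    rw [List.reverse_nil, List.nil_append] at hRL
    subst hRL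
    exact ⟨by omega, hr, hm, hM, hf⟩

/-- The addresses of the items below `n` stand in the memory from the address `A` on. The items
lie below the address `E`. -/
def Table (f : Formula) (A n E : ℕ) (M : ℕ → ℕ) : Prop :=
  ∀ p < n, Spells M (M (A + p)) ((item f p).length :: item f p) ∧
    M (A + p) + (item f p).length < E

theorem Table.congr {f : Formula} {A n E : ℕ} {M M' : ℕ → ℕ} (h : Table f A n E M)
    (hA : A + n ≤ E) (hM : ∀ x < E, M' x = M x) : Table f A n E M' := by
  intro p hp
  obtain ⟨h₁, h₂⟩ := h p hp
  rw [hM _ (by omega)]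
  refine ⟨h₁.congr fun x _ hx => hM x ?_, h₂⟩
  rw [List.length_cons] at hx
  omega

/-- Computes the entry `(R₁₄, R₁₃ - 1)` of the matrix of conflicts. -/
def conflictPair : Program :=
  .sub 15 13 9 ;; .add 10 10 9 ;; .const 11 0 ;;
  .sub 16 14 15 ;; .sub 17 15 14 ;; .add 16 16 17 ;;
  .ifNonzero 16
    (.add 20 5 14 ;; .load 20 20 ;; scan ;; .add 20 5 15 ;; .load 20 20 ;; scan) skip ;;
  put 6 14 15 11 ;; .sub 13 13 9

/-- A new stamp, larger than all existing marks, makes every old mark stale, so the unbounded range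
of variable indices never has to be cleared. Scanning both terms with the same stamp tests whether
their concatenation has a repetition. -/
theorem conflictPair_spec {f : Formula} {A B E n t p q : ℕ} (σ : State) (h4 : σ.reg 4 = n)
    (h5 : σ.reg 5 = A) (h6 : σ.reg 6 = E) (h8 : σ.reg 8 = B) (h9 : σ.reg 9 = 1)
    (h13 : σ.reg 13 = q + 1) (h14 : σ.reg 14 = p) (hp : p < n) (hq : q < n)
    (hA : A + n ≤ E) (hB : E + n * n ≤ B) (hf : Table f A n E σ.mem)
    (ht : ∀ p, (item f p).length ≤ t) (hM : ∀ x, σ.mem (B + x) ≤ σ.reg 10) :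
    wp conflictPair (fun T τ => T ≤ 18 * t + 3 * n + 30 ∧ τ.reg 13 = q ∧
      (∀ r < 15, r ≠ 10 → r ≠ 11 → r ≠ 13 → τ.reg r = σ.reg r) ∧
      (∀ x < E, τ.mem x = σ.mem x) ∧ (∀ x, τ.mem (B + x) ≤ τ.reg 10) ∧
      ∀ p' q', matrix E n τ.mem p' q' ↔
        if p' = p ∧ q' = q then Conflict f n p q else matrix E n σ.mem p' q') σ := by
  have hentry := entry_lt hp hq
  simp only [conflictPair, wp_seq, wp_sub, wp_add, wp_const]
  simp (disch := omega) only [setReg_reg_self, setReg_reg_ne, h9, h13, h14, Nat.add_sub_cancel]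
  -- The common tail of both branches: writing the computed flag into the matrix and decreasing the
  -- column counter.
  have hend : ∀ (T : ℕ) (τ : State), T ≤ 18 * t + 10 → (∀ r < 20, r ≠ 10 → r ≠ 11 → r ≠ 13 →
      r ≠ 15 → r ≠ 16 → r ≠ 17 → τ.reg r = σ.reg r) → τ.reg 13 = q + 1 → τ.reg 15 = q →
      (∀ x < B, τ.mem x = σ.mem x) → (∀ x, τ.mem (B + x) ≤ τ.reg 10) →
      (τ.reg 11 ≠ 0 ↔ Conflict f n p q) →
      wp (put 6 14 15 11) (fun U υ => 1 + (1 + (1 + (1 + (1 + (1 + (T + (U + 1))))))) ≤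
        18 * t + 3 * n + 30 ∧ (υ.setReg 13 (υ.reg 13 - υ.reg 9)).reg 13 = q ∧
        (∀ r < 15, r ≠ 10 → r ≠ 11 → r ≠ 13 →
          (υ.setReg 13 (υ.reg 13 - υ.reg 9)).reg r = σ.reg r) ∧
        (∀ x < E, (υ.setReg 13 (υ.reg 13 - υ.reg 9)).mem x = σ.mem x) ∧
        (∀ x, (υ.setReg 13 (υ.reg 13 - υ.reg 9)).mem (B + x) ≤
          (υ.setReg 13 (υ.reg 13 - υ.reg 9)).reg 10) ∧
        ∀ p' q', matrix E n (υ.setReg 13 (υ.reg 13 - υ.reg 9)).mem p' q' ↔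
          if p' = p ∧ q' = q then Conflict f n p q else matrix E n σ.mem p' q') τ := by
    intro T τ hT hr h13' h15 hm hM' h11
    refine wp_put (by omega) (by omega) (by omega) (by omega) ?_ ?_
    · simp (disch := omega) only [hr, h9]
    simp (disch := omega) only [hr, h15, h4, h6, h14]
    intro U υ hU hrυ hmυ
    simp (disch := omega) only [setReg_reg_self, setReg_reg_ne, setReg_mem, hrυ, hr, h9, h13', hmυ]
    refine ⟨by omega, by omega, ?_, ?_, ?_, ?_⟩
    · intro r h₁ h₂ h₃ h₄
      simp (disch := omega) only [setReg_reg_ne, hrυ, hr]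
    · intro x hx
      rw [Function.update_of_ne (by omega), hm x (by omega)]
    · intro x
      rw [Function.update_of_ne (by omega)]
      exact hM' x
    · intro p' q'
      rw [matrix_update hp hq]
      split_ifs
      · exact h11
      · exact matrix_congr fun x _ hx => hm x (by omega)
  -- The tested register holds the sum of the two truncated differences of `p` and `q`, which is
  -- zero iff they are equal. On the diagonal the flag stays `0`.
  by_cases hpq : p = q
  · refine wp_if_neg ?_ ?_
    · rw [setReg_reg_self]; omega
    rw [skip, wp_const]
    refine hend 2 _ (by omega) ?_ ?_ ?_ ?_ ?_ ?_ <;>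
      try simp (disch := omega) only [setReg_reg_self, setReg_reg_ne, setReg_mem, h13]
    · intro r h₁ h₂ h₃ h₄ h₅ h₆ h₇
      simp (disch := omega) only [setReg_reg_ne]
    · exact fun _ _ => trivial
    · exact fun x => (hM x).trans (Nat.le_succ _)
    · simp [Conflict, hpq]
  · refine wp_if_pos ?_ ?_
    · rw [setReg_reg_self]; omega
    simp only [wp_seq, wp_add, wp_load]
    simp (disch := omega) only [setReg_reg_self, setReg_reg_ne, setReg_mem, h5, h14]
    obtain ⟨hp₁, hp₂⟩ := hf p hp
    obtain ⟨hq₁, hq₂⟩ := hf q hq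
    refine (scan_spec (B := B) (s := σ.reg 10 + 1) (S := item f p) (L := []) _
      ?_ ?_ ?_ ?_ ?_ ?_ ?_).mono ?_ <;>
      simp (disch := omega) only [setReg_reg_self, setReg_reg_ne, setReg_mem, h8, h9]
    · exact hp₁
    · omega
    · intro x
      have := hM x
      refine ⟨by omega, ?_⟩
      simp only [List.not_mem_nil, iff_false]
      omega
    · simp
    rintro T₁ σ₁ ⟨hT₁, hr₁, hm₁, hM₁, hf₁⟩
    simp (disch := omega) only [hr₁, setReg_reg_self, setReg_reg_ne, setReg_mem, h5, hm₁]
    refine (scan_spec (B := B) (s := σ.reg 10 + 1) (S := item f q) (L := (item f p).reverse ++ []) _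
      ?_ ?_ ?_ ?_ ?_ ?_ ?_).mono ?_ <;>
      simp (disch := omega) only [setReg_reg_self, setReg_reg_ne, setReg_mem, h8, h9, hr₁, hm₁]
    · refine hq₁.congr fun x _ hx => hm₁ x ?_
      rw [List.length_cons] at hx
      omega
    · omega
    · exact hM₁
    · exact hf₁
    rintro T₂ σ₂ ⟨hT₂, hr₂, hm₂, hM₂, hf₂⟩
    have htp := ht p
    have htq := ht q
    refine hend _ _ (by omega) ?_ ?_ ?_ ?_ ?_ ?_
    · intro r h₁ h₂ h₃ h₄ h₅ h₆ h₇
      simp (disch := omega) only [setReg_reg_ne, hr₂, hr₁]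
    · simp (disch := omega) only [setReg_reg_ne, hr₂, hr₁, h13]
    · simp (disch := omega) only [setReg_reg_ne, setReg_reg_self, hr₂, hr₁]
    · intro x hx
      rw [hm₂ x hx, hm₁ x hx]
    · intro x
      simp (disch := omega) only [setReg_reg_ne, setReg_reg_self, hr₂, hr₁]
      exact (hM₂ x).1
    · rw [ne_eq, hf₂, List.append_nil, ← List.reverse_append, List.nodup_reverse]
      simp [Conflict, hp, hq, hpq]

/-- Computes the matrix of conflicts. -/
def conflicts : Program :=
  mov 12 4 ;;
  .whileNonzero 12
    (.sub 14 12 9 ;; mov 13 4 ;; .whileNonzero 13 conflictPair ;; .sub 12 12 9)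

theorem conflicts_spec {f : Formula} {A B E n t : ℕ} (σ : State) (h4 : σ.reg 4 = n)
    (h5 : σ.reg 5 = A) (h6 : σ.reg 6 = E) (h8 : σ.reg 8 = B) (h9 : σ.reg 9 = 1)
    (hA : A + n ≤ E) (hB : E + n * n ≤ B) (hf : Table f A n E σ.mem)
    (ht : ∀ p, (item f p).length ≤ t) (hM : ∀ x, σ.mem (B + x) ≤ σ.reg 10) :
    wp conflicts (fun T τ => T ≤ n * (n * (18 * t + 3 * n + 30 + 1) + 10) + 10 ∧
      (∀ r < 10, τ.reg r = σ.reg r) ∧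
      ∀ p q, matrix E n τ.mem p q ↔ Conflict f n p q) σ := by
  rw [conflicts, wp_seq]
  refine wp_mov (by omega) ?_
  rw [h4]
  refine (wp_while (fun i τ => τ.reg 12 = i ∧ i ≤ n ∧ (∀ r < 10, τ.reg r = σ.reg r) ∧
    (∀ x < E, τ.mem x = σ.mem x) ∧ (∀ x, τ.mem (B + x) ≤ τ.reg 10) ∧
    ∀ p q, p < n → q < n → i ≤ p → (matrix E n τ.mem p q ↔ Conflict f n p q))
    (n * (18 * t + 3 * n + 30 + 1) + 8) (fun τ h => h.1) ?_ n _ ?_).mono ?_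
  · rintro i τ ⟨h12, hi, hr, hm, hM, hD⟩
    refine ⟨by omega, ?_⟩
    simp only [wp_seq, wp_sub]
    refine wp_mov (by omega) ?_
    simp (disch := omega) only [setReg_reg_ne, setReg_reg_self, hr, h12, h9, h4]
    refine (wp_while (fun j τ' => τ'.reg 13 = j ∧ j ≤ n ∧ τ'.reg 14 = i ∧ τ'.reg 12 = i + 1 ∧
      (∀ r < 10, τ'.reg r = σ.reg r) ∧ (∀ x < E, τ'.mem x = σ.mem x) ∧
      (∀ x, τ'.mem (B + x) ≤ τ'.reg 10) ∧
      ∀ p q, p < n → q < n → (i + 1 ≤ p ∨ p = i ∧ j ≤ q) →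
        (matrix E n τ'.mem p q ↔ Conflict f n p q)) (18 * t + 3 * n + 30) (fun τ h => h.1)
      ?_ n _ ?_).mono ?_
    · rintro j υ ⟨h13, hj, h14, h12', hr', hm', hM', hD'⟩
      refine ⟨by omega, ?_⟩
      refine (conflictPair_spec (A := A) (B := B) (n := n) (t := t) (p := i) (q := j) υ
        ?_ ?_ ?_ ?_ ?_ h13 h14 (by omega) (by omega) hA hB (hf.congr hA hm') ht hM').mono ?_ <;>
        try simp (disch := omega) only [hr', h4, h5, h6, h8, h9]
      rintro T υ' ⟨hT, h13', hr'', hm'', hM'', hD''⟩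
      refine ⟨hT, h13', by omega, ?_, ?_, ?_, ?_, hM'', ?_⟩
      · rw [hr'' _ (by omega) (by omega) (by omega) (by omega), h14]
      · rw [hr'' _ (by omega) (by omega) (by omega) (by omega), h12']
      · intro r hlt
        rw [hr'' _ (by omega) (by omega) (by omega) (by omega), hr' _ hlt]
      · intro x hx
        rw [hm'' x hx, hm' x hx]
      · intro p q hp hq hpq
        rw [hD'']
        split_ifs with h
        · rw [h.1, h.2]
        · exact hD' p q hp hq (by omega)
    · simp (disch := omega) only [setReg_reg_ne, setReg_reg_self, setReg_mem, h12]
      refine ⟨trivial, le_rfl, by omega, trivial, ?_, hm, hM, ?_⟩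
      · intro r hlt
        simp (disch := omega) only [setReg_reg_ne, hr]
      · intro p q hp hq hpq
        exact hD p q hp hq (by omega)
    · rintro T υ ⟨hT, h13, -, h14, h12', hr', hm', hM', hD'⟩
      simp (disch := omega) only [setReg_reg_ne, setReg_reg_self, setReg_mem, h12', hr', h9]
      refine ⟨by omega, by omega, by omega, ?_, hm', hM', ?_⟩
      · intro r hlt
        simp (disch := omega) only [setReg_reg_ne, hr']
      · intro p q hp hq hpq
        exact hD' p q hp hq (by omega)
  · simp (disch := omega) only [setReg_reg_ne, setReg_reg_self, setReg_mem]
    refine ⟨trivial, le_rfl, ?_, fun _ _ => trivial, hM, ?_⟩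
    · intro r hlt
      simp (disch := omega) only [setReg_reg_ne]
    · intro p q hp hq hpq
      omega
  · rintro T τ ⟨hT, -, -, hr, hm, hM, hD⟩
    refine ⟨?_, hr, fun p q => ?_⟩
    · have : n * (n * (18 * t + 3 * n + 30 + 1) + 8 + 1) ≤
          n * (n * (18 * t + 3 * n + 30 + 1) + 10) := Nat.mul_le_mul_left _ (by omega)
      omega
    · by_cases h : p < n ∧ q < n
      · exact hD p q h.1 h.2 (Nat.zero_le _)
      · refine iff_of_false (fun h' => h ⟨h'.1, h'.2.1⟩) (fun h' => h ⟨h'.1, h'.2.1⟩)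

/-! ### Reading the input -/

/-- The words that encode a term. -/
def encodeTerm (T : Term) : List ℕ := T.length :: T

/-- The words that encode a clause. -/
def encodeClause (F : Clause) : List ℕ := F.length :: F.flatMap encodeTerm

/-- `R₃ := ⌈R₁ / 2⌉`, `R₂ := 3 ^ R₃`, `R₄ := 6 R₃ + 1` -/
def sizes : Program :=
  .const 2 1 ;; .const 4 1 ;; .const 10 2 ;; .const 11 6 ;; mov 12 1 ;;
  .whileNonzero 12
    (.sub 12 12 10 ;; .add 3 3 9 ;; .add 13 2 2 ;; .add 2 2 13 ;; .add 4 4 11)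

/-- Subtracting `2` with truncation until `0` takes `⌈m/2⌉` rounds, so for odd `m` the last pair is
completed by a padding clause. -/
theorem sizes_spec {m : ℕ} (σ : State) (h1 : σ.reg 1 = m) (h3 : σ.reg 3 = 0) (h9 : σ.reg 9 = 1) :
    wp sizes (fun T τ => T ≤ 6 * ((m + 1) / 2) + 7 ∧ τ.reg 3 = (m + 1) / 2 ∧
      τ.reg 2 = 3 ^ ((m + 1) / 2) ∧ τ.reg 4 = 3 * (2 * ((m + 1) / 2)) + 1 ∧
      τ.reg 0 = σ.reg 0 ∧ τ.reg 1 = m ∧ τ.reg 9 = 1 ∧ τ.mem = σ.mem) σ := by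
  simp only [sizes, wp_seq, wp_const]
  refine wp_mov (by omega) ?_
  simp (disch := omega) only [setReg_reg_ne, h1]
  refine (wp_while (fun j τ => j ≤ (m + 1) / 2 ∧ τ.reg 12 = m - 2 * ((m + 1) / 2 - j) ∧
    τ.reg 3 = (m + 1) / 2 - j ∧ τ.reg 2 = 3 ^ ((m + 1) / 2 - j) ∧
    τ.reg 4 = 3 * (2 * ((m + 1) / 2 - j)) + 1 ∧ τ.reg 0 = σ.reg 0 ∧ τ.reg 1 = m ∧ τ.reg 9 = 1 ∧
    τ.reg 10 = 2 ∧ τ.reg 11 = 6 ∧ τ.mem = σ.mem) 5 (fun τ h => by omega) ?_ ((m + 1) / 2) _ ?_).mono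
    ?_
  · rintro j τ ⟨hj, h12, h3', h2, h4, h0, h1', h9', h10, h11, hm⟩
    refine ⟨by omega, ?_⟩
    simp (disch := omega) only [wp_seq, wp_add, wp_sub, setReg_reg_self, setReg_reg_ne, setReg_mem]
    have hl : (m + 1) / 2 - j = (m + 1) / 2 - (j + 1) + 1 := by omega
    refine ⟨by omega, by omega, by omega, by omega, ?_, by omega, h0, h1', h9', h10, h11, hm⟩
    rw [h2, hl, pow_succ]
    ring
  · simp (disch := omega) only [setReg_reg_self, setReg_reg_ne, setReg_mem, Nat.sub_self, h1, h3,
      h9]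
    simp
  · rintro T τ ⟨hT, -, -, h3', h2, h4, h0, h1', h9', -, -, hm⟩
    exact ⟨by omega, h3', h2, h4, h0, h1', h9', hm⟩

/-- `R₅ :=` the address behind the input -/
def findEnd : Program :=
  .const 5 1 ;; mov 12 1 ;;
  .whileNonzero 12
    (.load 13 5 ;; .add 5 5 9 ;;
      .whileNonzero 13 (.load 14 5 ;; .add 5 5 14 ;; .add 5 5 9 ;; .sub 13 13 9) ;;
      .sub 12 12 9)

/-- The degree words allow jumping over whole terms, so the time depends on the number of clauses
but not on the degrees. -/
theorem findEnd_spec {f : Formula} (σ : State) (h1 : σ.reg 1 = f.length) (h9 : σ.reg 9 = 1)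
    (hf : Spells σ.mem 1 (f.flatMap encodeClause)) (h3 : ∀ F ∈ f, F.length ≤ 3) :
    wp findEnd (fun T τ => T ≤ f.length * 20 + 4 ∧
      τ.reg 5 = 1 + (f.flatMap encodeClause).length ∧
      (∀ r < 12, r ≠ 5 → τ.reg r = σ.reg r) ∧ τ.mem = σ.mem) σ := by
  simp only [findEnd, wp_seq, wp_const]
  refine wp_mov (by omega) ?_
  simp (disch := omega) only [setReg_reg_ne, h1]
  refine (wp_while (fun j τ => τ.reg 12 = j ∧ (∀ r < 12, r ≠ 5 → τ.reg r = σ.reg r) ∧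
    τ.mem = σ.mem ∧ ∃ g : Formula, g.length = j ∧ (∀ F ∈ g, F.length ≤ 3) ∧
    Spells σ.mem (τ.reg 5) (g.flatMap encodeClause) ∧
    τ.reg 5 + (g.flatMap encodeClause).length = 1 + (f.flatMap encodeClause).length) 19
    (fun τ h => h.1) ?_ f.length _ ?_).mono ?_
  · rintro j τ ⟨h12, hr, hm, g, hg, hg3, hs, he⟩
    refine ⟨by omega, ?_⟩
    obtain _ | ⟨F, g⟩ := g
    · simp at hg
    rw [List.flatMap_cons, spells_append] at hs
    rw [List.flatMap_cons, List.length_append] at he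
    rw [List.length_cons] at hg
    simp (disch := omega) only [wp_seq, wp_load, wp_add, setReg_reg_ne, setReg_reg_self, hr, hm,
      hs.1.1, h9]
    have hF3 := hg3 F (by simp)
    refine (wp_while (fun i τ' => τ'.reg 13 = i ∧ τ'.reg 12 = j + 1 ∧
      (∀ r < 12, r ≠ 5 → τ'.reg r = σ.reg r) ∧ τ'.mem = σ.mem ∧ ∃ G : Clause, G.length = i ∧
      Spells σ.mem (τ'.reg 5) (G.flatMap encodeTerm) ∧
      τ'.reg 5 + (G.flatMap encodeTerm).length = τ.reg 5 + (encodeClause F).length) 4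
      (fun τ h => h.1) ?_ F.length _ ?_).mono ?_
    · rintro i υ ⟨h13, h12', hr', hm', G, hG, hs', he'⟩
      refine ⟨by omega, ?_⟩
      obtain _ | ⟨T, G⟩ := G
      · simp at hG
      rw [List.flatMap_cons, spells_append] at hs'
      rw [List.flatMap_cons, List.length_append] at he'
      have hlen : (encodeTerm T).length = T.length + 1 := rfl
      rw [hlen] at hs' he'
      rw [List.length_cons] at hG
      simp (disch := omega) only [wp_seq, wp_load, wp_add, wp_sub, setReg_reg_ne, setReg_reg_self,
        setReg_mem, hr', hm', hs'.1.1, h9, h13]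
      refine ⟨le_rfl, by omega, h12', ?_, trivial, G, by omega, hs'.2, by omega⟩
      intro r h₁ h₂
      simp (disch := omega) only [setReg_reg_ne, hr']
    · simp (disch := omega) only [setReg_reg_ne, setReg_reg_self, setReg_mem, h12, hm]
      refine ⟨trivial, trivial, ?_, trivial, F, rfl, hs.1.2, ?_⟩
      · intro r h₁ h₂
        simp (disch := omega) only [setReg_reg_ne, hr]
      · rw [encodeClause, List.length_cons]; ring
    · rintro T υ ⟨hT, h13, h12', hr', hm', G, hG, -, he'⟩
      obtain rfl := List.length_eq_zero_iff.1 hG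
      rw [List.flatMap_nil, List.length_nil, add_zero] at he'
      simp (disch := omega) only [wp_sub, setReg_reg_ne, setReg_reg_self, setReg_mem, hr', h12', h9]
      refine ⟨by omega, by omega, ?_, hm', g, by omega, fun F hF => hg3 F (by simp [hF]), ?_, ?_⟩
      · intro r h₁ h₂
        simp (disch := omega) only [setReg_reg_ne, hr']
      · rw [he']; exact hs.2
      · omega
  · simp (disch := omega) only [setReg_reg_ne, setReg_reg_self, setReg_mem]
    refine ⟨trivial, ?_, trivial, f, rfl, h3, hf, rfl⟩
    intro r h₁ h₂
    simp (disch := omega) only [setReg_reg_ne]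
  · rintro T τ ⟨hT, -, hr, hm, g, hg, -, -, he⟩
    obtain rfl := List.length_eq_zero_iff.1 hg
    exact ⟨by omega, by simpa using he, hr, hm⟩

/-- Writes the addresses of the terms of the clause at `R₂₀` into three cells from `R₂₁` on. -/
def fillClause : Program :=
  .load 14 20 ;; .add 20 20 9 ;; .store 21 20 ;; .add 22 21 9 ;; .store 22 20 ;; .add 22 22 9 ;;
  .store 22 20 ;; mov 22 21 ;;
  .whileNonzero 14
    (.store 22 20 ;; .add 22 22 9 ;; .load 23 20 ;; .add 20 20 23 ;; .add 20 20 9 ;; .sub 14 14 9) ;;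
  .add 21 21 13 ;; .sub 12 12 9

/-- All three cells first receive the address of the first term and are then overwritten as far as
terms exist. This matches the default value in `clauseItem`. -/
theorem fillClause_spec {F : Clause} {N : ℕ} (σ : State) (h9 : σ.reg 9 = 1) (h13 : σ.reg 13 = 3)
    (hs : Spells σ.mem (σ.reg 20) (encodeClause F))
    (hN : σ.reg 20 + (encodeClause F).length ≤ N) (h21 : N ≤ σ.reg 21) (h₁ : 1 ≤ F.length)
    (h₃ : F.length ≤ 3) :
    wp fillClause (fun T τ => T ≤ 33 ∧ τ.reg 12 = σ.reg 12 - 1 ∧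
      τ.reg 20 = σ.reg 20 + (encodeClause F).length ∧ τ.reg 21 = σ.reg 21 + 3 ∧
      (∀ r < 14, r ≠ 12 → τ.reg r = σ.reg r) ∧
      (∀ x, x < σ.reg 21 ∨ σ.reg 21 + 3 ≤ x → τ.mem x = σ.mem x) ∧
      ∀ j < 3, Spells σ.mem (τ.mem (σ.reg 21 + j)) (encodeTerm (clauseItem F j)) ∧
        τ.mem (σ.reg 21 + j) + (clauseItem F j).length < N) σ := by
  simp only [fillClause, wp_seq, wp_load, wp_add, wp_store]
  refine wp_mov (by omega) ?_
  simp (disch := omega) only [setReg_reg_ne, setReg_reg_self, setMem_reg, setMem_mem, setReg_mem,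
    hs.1, h9]
  set a := σ.reg 21 with ha
  have hE : ∀ (G : Clause) (b : ℕ), Spells σ.mem b (G.flatMap encodeTerm) → 1 ≤ G.length →
      b + (G.flatMap encodeTerm).length ≤ N →
      Spells σ.mem b (encodeTerm (clauseItem G 0)) ∧ b + (clauseItem G 0).length < N := by
    intro G b hG hG₁ hlen
    obtain _ | ⟨T, G⟩ := G
    · simp at hG₁
    rw [List.flatMap_cons, spells_append] at hG
    rw [List.flatMap_cons, List.length_append] at hlen
    have : (encodeTerm T).length = T.length + 1 := rfl
    exact ⟨hG.1, by simp [clauseItem]; omega⟩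
  have hlenF : (encodeClause F).length = (F.flatMap encodeTerm).length + 1 := rfl
  have hE₀ := hE F (σ.reg 20 + 1) hs.2 h₁ (by omega)
  refine (wp_while (fun j τ => j ≤ F.length ∧ τ.reg 14 = j ∧ τ.reg 12 = σ.reg 12 ∧ τ.reg 21 = a ∧
    τ.reg 22 = a + (F.length - j) ∧ (∀ r < 14, r ≠ 12 → τ.reg r = σ.reg r) ∧
    (∀ x, x < a ∨ a + 3 ≤ x → τ.mem x = σ.mem x) ∧
    Spells σ.mem (τ.reg 20) ((F.drop (F.length - j)).flatMap encodeTerm) ∧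
    τ.reg 20 + ((F.drop (F.length - j)).flatMap encodeTerm).length =
      σ.reg 20 + (encodeClause F).length ∧
    ∀ c < 3, Spells σ.mem (τ.mem (a + c))
        (encodeTerm (clauseItem F (if c < F.length - j then c else 0))) ∧
      τ.mem (a + c) + (clauseItem F (if c < F.length - j then c else 0)).length < N) 6
      (fun τ h => h.2.1) ?_ F.length _ ?_).mono ?_
  · rintro j τ ⟨hj, h14, h12, h21', h22, hr, hm, hs', he, hc⟩
    refine ⟨by omega, ?_⟩
    have hl : F.length - j = F.length - (j + 1) + 1 := by omega
    have hlF : F.length - (j + 1) < F.length := by omega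
    rw [hl]
    generalize hli : F.length - (j + 1) = l at *
    have hE' := hE (F.drop l) (τ.reg 20) hs' (by rw [List.length_drop]; omega) (by omega)
    rw [List.drop_eq_getElem_cons hlF, List.flatMap_cons, spells_append] at hs'
    rw [List.drop_eq_getElem_cons hlF, List.flatMap_cons, List.length_append] at he
    have hlen : (encodeTerm F[l]).length = F[l].length + 1 := rfl
    have hitem : clauseItem (F.drop l) 0 = clauseItem F l := by
      simp [clauseItem, List.getD_eq_getElem, hlF]
    rw [hitem] at hE'
    have h20 : τ.reg 20 < a := by omega
    have hread : Function.update τ.mem (a + l) (τ.reg 20) (τ.reg 20) = F[l].length := by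
      rw [Function.update_of_ne (by omega), hm _ (by omega), hs'.1.1]
    simp (disch := omega) only [wp_seq, wp_load, wp_add, wp_sub, wp_store, setReg_reg_ne,
      setReg_reg_self, setReg_mem, setMem_reg, setMem_mem, hr, h22, h9, hread]
    refine ⟨le_rfl, by omega, by omega, h12, h21', by omega, ?_, ?_, ?_, ?_, ?_⟩
    · intro r hr₁ hr₂
      simp (disch := omega) only [setReg_reg_ne, setMem_reg, hr]
    · intro x hx
      rw [Function.update_of_ne (by omega), hm x hx]
    · rw [hlen] at hs'
      exact hs'.2
    · omega
    · intro c hc3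
      by_cases hcl : c = l
      · subst hcl
        rw [Function.update_self, if_pos (by omega)]
        exact hE'
      · rw [Function.update_of_ne (by omega)]
        have := hc c hc3
        by_cases hcl' : c < l
        · rw [if_pos hcl'] at this
          rwa [if_pos (by omega)]
        · rw [if_neg hcl'] at this
          rwa [if_neg (by omega)]
  · simp (disch := omega) only [setReg_reg_ne, setReg_reg_self, setReg_mem, setMem_reg, setMem_mem,
      Nat.sub_self, List.drop_zero]
    refine ⟨le_rfl, trivial, trivial, by omega, rfl, ?_, ?_, hs.2, by omega, ?_⟩
    · intro r hr₁ hr₂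
      simp (disch := omega) only [setReg_reg_ne, setMem_reg]
    · intro x hx
      rw [Function.update_of_ne (by omega), Function.update_of_ne (by omega),
        Function.update_of_ne (by omega)]
    · intro c hc3
      rw [if_neg (by omega)]
      have : Function.update (Function.update (Function.update σ.mem a (σ.reg 20 + 1)) (a + 1)
          (σ.reg 20 + 1)) (a + 1 + 1) (σ.reg 20 + 1) (a + c) = σ.reg 20 + 1 := by
        interval_cases c
        · rw [Function.update_of_ne (by omega), Function.update_of_ne (by omega), add_zero,
            Function.update_self]
        · rw [Function.update_of_ne (by omega), Function.update_self]
        · rw [show a + 1 + 1 = a + 2 from rfl, Function.update_self]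
      rw [this]
      exact hE₀
  · rintro T τ ⟨hT, -, h14, h12, h21', h22, hr, hm, -, he, hc⟩
    rw [Nat.sub_zero, List.drop_length, List.flatMap_nil, List.length_nil, add_zero] at he
    simp (disch := omega) only [wp_add, wp_sub, setReg_reg_ne, setReg_reg_self, setReg_mem, hr,
      h9, h12, h13, h21']
    refine ⟨by omega, trivial, he, trivial, ?_, hm, ?_⟩
    · intro r hr₁ hr₂
      simp (disch := omega) only [setReg_reg_ne, hr]
    · intro j hj
      have := hc j hj
      by_cases hjF : j < F.length
      · rwa [if_pos (by omega)] at this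
      · rw [if_neg (by omega)] at this
        have e : clauseItem F j = clauseItem F 0 := by
          rw [clauseItem, clauseItem, List.getD_eq_default _ _ (by omega),
            List.getD_eq_getElem _ _ h₁, List.getD_eq_getElem _ _ h₁]
        rwa [e]

/-- Writes the addresses of the terms of all clauses into the cells from `R₅` on, three for each
clause. -/
def fillTable : Program :=
  .const 20 1 ;; mov 21 5 ;; mov 12 1 ;; .const 13 3 ;; .whileNonzero 12 fillClause

theorem fillTable_spec {f : Formula} {N : ℕ} (σ : State) (h1 : σ.reg 1 = f.length)
    (h5 : σ.reg 5 = N) (h9 : σ.reg 9 = 1) (hf : Spells σ.mem 1 (f.flatMap encodeClause))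
    (hN : N = 1 + (f.flatMap encodeClause).length) (h₁ : ∀ F ∈ f, 1 ≤ F.length)
    (h₃ : ∀ F ∈ f, F.length ≤ 3) :
    wp fillTable (fun T τ => T ≤ f.length * 34 + 7 ∧ (∀ r < 12, τ.reg r = σ.reg r) ∧
      (∀ x, x < N ∨ N + 3 * f.length ≤ x → τ.mem x = σ.mem x) ∧
      ∀ p < 3 * f.length, Spells σ.mem (τ.mem (N + p)) (encodeTerm (item f p)) ∧
        τ.mem (N + p) + (item f p).length < N) σ := by
  simp only [fillTable, wp_seq, wp_const]
  refine wp_mov (by omega) (wp_mov (by omega) ?_)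
  simp (disch := omega) only [setReg_reg_ne, h1, h5]
  refine (wp_while (fun j τ => j ≤ f.length ∧ τ.reg 12 = j ∧ τ.reg 13 = 3 ∧
    τ.reg 21 = N + 3 * (f.length - j) ∧ (∀ r < 12, τ.reg r = σ.reg r) ∧
    (∀ x, x < N ∨ N + 3 * f.length ≤ x → τ.mem x = σ.mem x) ∧
    Spells σ.mem (τ.reg 20) ((f.drop (f.length - j)).flatMap encodeClause) ∧
    τ.reg 20 + ((f.drop (f.length - j)).flatMap encodeClause).length = N ∧
    ∀ p < 3 * (f.length - j), Spells σ.mem (τ.mem (N + p)) (encodeTerm (item f p)) ∧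
      τ.mem (N + p) + (item f p).length < N) 33
      (fun τ h => h.2.1) ?_ f.length _ ?_).mono ?_
  · rintro j τ ⟨hj, h12, h13, h21, hr, hm, hs, he, hp⟩
    refine ⟨by omega, ?_⟩
    have hl : f.length - j = f.length - (j + 1) + 1 := by omega
    have hlf : f.length - (j + 1) < f.length := by omega
    rw [hl]
    generalize f.length - (j + 1) = l at *
    rw [List.drop_eq_getElem_cons hlf, List.flatMap_cons, spells_append] at hs
    rw [List.drop_eq_getElem_cons hlf, List.flatMap_cons, List.length_append] at he
    have hmem : f[l] ∈ f := List.getElem_mem hlf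
    have hsp : Spells τ.mem (τ.reg 20) (encodeClause f[l]) :=
      hs.1.congr fun x _ hx => hm x (by omega)
    refine (fillClause_spec (F := f[l]) (N := N) τ (by rw [hr 9 (by omega), h9]) h13 hsp (by omega)
      (by omega) (h₁ _ hmem) (h₃ _ hmem)).mono ?_
    rintro T υ ⟨hT, h12', h20', h21', hr', hm', hp'⟩
    refine ⟨hT, by omega, by omega, by rw [hr' _ (by omega) (by omega), h13], by omega, ?_, ?_, ?_,
      by omega, ?_⟩
    · intro r hlt
      rw [hr' r (by omega) (by omega), hr r hlt]
    · intro x hx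
      rw [hm' x (by omega), hm x hx]
    · rw [h20']; exact hs.2
    · intro p hp3
      by_cases hpl : p < 3 * l
      · rw [hm' _ (by omega)]
        exact hp p hpl
      · obtain ⟨c, rfl⟩ := Nat.exists_eq_add_of_le (not_lt.1 hpl)
        have hc3 : c < 3 := by omega
        have hpc := hp' c hc3
        rw [h21, add_assoc] at hpc
        rw [item_eq hc3, List.getD_eq_getElem _ _ hlf]
        refine ⟨hpc.1.congr fun x _ hx => (hm x ?_).symm, hpc.2⟩
        have : (encodeTerm (clauseItem f[l] c)).length = (clauseItem f[l] c).length + 1 := rfl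
        omega
  · simp (disch := omega) only [setReg_reg_ne, setReg_reg_self, setReg_mem, Nat.sub_self,
      List.drop_zero]
    refine ⟨le_rfl, trivial, trivial, by omega, ?_, fun _ _ => trivial, hf, by omega, by omega⟩
    intro r hlt
    simp (disch := omega) only [setReg_reg_ne]
  · rintro T τ ⟨hT, -, -, -, -, hr, hm, -, -, hp⟩
    exact ⟨by omega, hr, hm, hp⟩

theorem spells_of_getD {M : ℕ → ℕ} {a : ℕ} {l : List ℕ}
    (h : ∀ i < l.length, M (a + i) = l.getD i 0) : Spells M a l := by
  induction l generalizing a with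
  | nil => trivial
  | cons x l ih =>
    refine ⟨by simpa using h 0 (by simp), ih fun i hi => ?_⟩
    have := h (i + 1) (by simpa using hi)
    rwa [List.getD_cons_succ, ← add_assoc, add_right_comm] at this

/-! ### The whole program -/

/-- Decides whether the input has a multilinear monomial. -/
def program : Program :=
  .const 9 1 ;; .load 1 0 ;; .store 0 10 ;; sizes ;; findEnd ;;
  .add 6 5 4 ;; .const 12 0 ;; cell 6 4 12 ;; mov 7 30 ;; cell 7 4 12 ;; mov 8 30 ;;
  fillTable ;; conflicts ;; search

/-- The program is correct, and its time is bounded in terms of the number `k` of pairs of clauses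
and the number `n` of items. -/
theorem program_spec {f : Formula} {m t k n : ℕ} (hf : IsPiSigmaPi m 3 t f) (hk : k = (m + 1) / 2)
    (hn : n = 3 * (2 * k) + 1) :
    wp program (fun T τ =>
      T ≤ (6 * k + m * 54 + 6 * n + 80 + n * (n * (18 * t + 3 * n + 30 + 1) + 10)) +
        3 ^ k * (n * n * 6 + k * (2 * elimTime n + 26 + 1) + 3 * n + 30 + 1) ∧
      (HasMultilinearMonomial f → τ.reg 0 = 1) ∧ (¬ HasMultilinearMonomial f → τ.reg 0 = 0))
      (initialState f) := by
  have hlen := hf.length_eq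
  set L := f.flatMap encodeClause with hL
  have henc : Formula.encode f = m :: L := by rw [← hlen]; rfl
  have hM0 : (initialState f).mem 0 = m := by simp [initialState, henc]
  have hM1 : ∀ x, (initialState f).mem (1 + x) = L.getD x 0 := by
    intro x
    simp [initialState, henc, add_comm 1 x]
  have hR : ∀ r, (initialState f).reg r = 0 := fun _ => rfl
  generalize initialState f = σ at *
  simp only [program, wp_seq, wp_const, wp_load, wp_store]
  refine (sizes_spec (m := m) _ ?_ ?_ ?_).mono ?_ <;>
    simp (disch := omega) only [setReg_reg_ne, setReg_reg_self, setReg_mem, setMem_reg, setMem_mem,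
      hR, hM0]
  rintro T₁ σ₁ ⟨hT₁, h3, h2, h4, h0, h1, h9, hm₁⟩
  rw [← hk] at hT₁ h3 h2 h4
  rw [← hn] at h4
  have hs₁ : Spells σ₁.mem 1 L := by
    refine spells_of_getD fun i hi => ?_
    rw [hm₁, Function.update_of_ne (by omega), hM1]
  refine (findEnd_spec (f := f) σ₁ (by rw [h1, hlen]) h9 hs₁ hf.terms_le).mono ?_
  rintro T₂ σ₂ ⟨hT₂, h5, hr₂, hm₂⟩
  rw [← hL] at h5
  set N := 1 + L.length with hN
  rw [wp_add]
  refine (cell_spec 6 4 12 (by omega) (by omega) (by omega) _ ?_).mono ?_ <;>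
    simp (disch := omega) only [setReg_reg_ne, setReg_reg_self, setReg_mem, hr₂, h9, h4, h5]
  rintro T₃ σ₃ ⟨hT₃, h30, hr₃, hm₃⟩
  refine wp_mov (by omega) ?_
  refine (cell_spec 7 4 12 (by omega) (by omega) (by omega) _ ?_).mono ?_ <;>
    simp (disch := omega) only [setReg_reg_ne, setReg_reg_self, setReg_mem, hr₂, hr₃, h30, h9, h4]
  rintro T₄ σ₄ ⟨hT₄, h30', hr₄, hm₄⟩
  refine wp_mov (by omega) ?_
  rw [h30']
  -- Cell `0`, whose content `m` has been read, was overwritten with `0`, so address `0` now spells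
  -- the empty term.
  have hm₄' : σ₄.mem = Function.update σ.mem 0 0 := by rw [hm₄, hm₃, hm₂, hm₁]
  refine (fillTable_spec (f := f) (N := N) _ ?_ ?_ ?_ ?_ hN hf.one_le_terms hf.terms_le).mono ?_ <;>
    simp (disch := omega) only [setReg_reg_ne, setReg_reg_self, setReg_mem, hr₂, hr₃, hr₄, h9, h5,
      h1, hlen]
  · rw [hm₄', ← hm₁]; exact hs₁
  rintro T₅ σ₅ ⟨hT₅, hr₅, hm₅, hp₅⟩
  have hmn : 3 * m < n := by omega
  -- Untouched zero cells serve twice: as table entries of the padding items and of the permanent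
  -- item, all pointing to the empty term at address `0`, and as initial marks.
  have hz : ∀ x, N + 3 * m ≤ x → σ₅.mem x = 0 := by
    intro x hx
    rw [hm₅ x (.inr hx), hm₄', Function.update_of_ne (by omega)]
    obtain ⟨y, rfl⟩ := Nat.exists_eq_add_of_le (show 1 ≤ x by omega)
    rw [hM1, List.getD_eq_default _ _ (by omega)]
  have htable : Table f N n (N + n) σ₅.mem := by
    intro p hp
    by_cases hpm : p < 3 * m
    · obtain ⟨h₁, h₂⟩ := hp₅ p hpm
      refine ⟨h₁.congr fun x _ hx => hm₅ x (.inl ?_), by omega⟩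
      have : (encodeTerm (item f p)).length = (item f p).length + 1 := rfl
      omega
    · rw [item_of_le (by omega), hz (N + p) (by omega)]
      refine ⟨⟨?_, trivial⟩, ?_⟩
      · rw [hm₅ 0 (.inl (by omega)), hm₄', Function.update_self]; rfl
      · rw [List.length_nil]; omega
  have ht : ∀ p, (item f p).length ≤ t := by
    intro p
    by_cases hp : p < 3 * f.length
    · have hlt : p / 3 < f.length := by omega
      rw [item, List.getD_eq_getElem _ _ hlt]
      exact hf.degree_le _ (List.getElem_mem hlt) _
        (clauseItem_mem (hf.one_le_terms _ (List.getElem_mem hlt)) _)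
    · rw [item_of_le (by omega)]; exact Nat.zero_le _
  -- Memory layout: the input below `N`, the table of `n` addresses, the conflict matrix, its
  -- working copy, and finally the marks, which are unbounded above.
  refine (conflicts_spec (f := f) (A := N) (E := N + n) (B := N + n + n * n + n * n) (n := n)
    (t := t) σ₅ ?_ ?_ ?_ ?_ ?_ le_rfl ?_ htable ht ?_).mono ?_ <;>
    try simp (disch := omega) only [setReg_reg_ne, setReg_reg_self, setReg_mem, hr₂, hr₃, hr₄,
      hr₅, h9, h5, h4, h30, add_zero]
  · omega
  · intro x
    rw [hz _ (by omega)]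
    exact Nat.zero_le _
  rintro T₆ σ₆ ⟨hT₆, hr₆, hD₆⟩
  have hD : matrix (N + n) n σ₆.mem = Conflict f n := by
    funext p q
    exact propext (hD₆ p q)
  refine (search_spec (A := N + n) (n := n) (k := k) σ₆ ?_ ?_ ?_ ?_ ?_ ?_ ?_ hn ?_).mono ?_ <;>
    try simp (disch := omega) only [setReg_reg_ne, setReg_reg_self, setReg_mem, setMem_reg, hr₂,
      hr₃, hr₄, hr₅, hr₆, h9, h5, h4, h3, h2, h0, h30, hR, add_zero]
  · intro p q
    rw [hD]
    exact Conflict.symm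
  rw [hD, hn, ← hasMultilinearMonomial_iff_solvable hf (by omega), ← hn]
  rintro T₇ σ₇ ⟨hT₇, hyes, hno⟩
  refine ⟨?_, hyes, hno⟩
  rw [hlen] at hT₂
  omega

/-! ### The time bound -/

/-- A coarse bound suffices: every power of `n` that occurs is at most `n ^ 5`, and `n ≤ 3 * m + 4 ≤
7 * m`. -/
theorem time_le {m t k n : ℕ} (hm : 1 ≤ m) (ht : 1 ≤ t) (hk : k = (m + 1) / 2)
    (hn : n = 3 * (2 * k) + 1) :
    (6 * k + m * 54 + 6 * n + 80 + n * (n * (18 * t + 3 * n + 30 + 1) + 10)) +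
      3 ^ k * (n * n * 6 + k * (2 * elimTime n + 26 + 1) + 3 * n + 30 + 1) ≤
    1000 * (3 ^ k * (t * (7 * m) ^ 5)) := by
  have hn₁ : 1 ≤ n := by omega
  have hkn : k ≤ n := by omega
  have hmn : m ≤ n := by omega
  have hn7 : n ≤ 7 * m := by omega
  have h3 : 1 ≤ 3 ^ k := Nat.one_le_pow _ _ (by norm_num)
  have hpow : ∀ i, i ≤ 5 → n ^ i ≤ n ^ 5 := fun i hi => Nat.pow_le_pow_right hn₁ hi
  have h0 : 1 ≤ n ^ 5 := Nat.one_le_pow _ _ hn₁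
  have h1 : n ≤ n ^ 5 := by simpa using hpow 1 (by norm_num)
  have h2 := hpow 2 (by norm_num)
  have h3' := hpow 3 (by norm_num)
  have h4 := hpow 4 (by norm_num)
  have hA : 6 * k + m * 54 + 6 * n + 80 + n * (n * (18 * t + 3 * n + 30 + 1) + 10) ≤
      300 * (t * n ^ 5) := by
    have e : n * (n * (18 * t + 3 * n + 30 + 1) + 10) =
        18 * (t * n ^ 2) + 3 * n ^ 3 + 31 * n ^ 2 + 10 * n := by ring
    have f₁ : t * n ^ 2 ≤ t * n ^ 5 := Nat.mul_le_mul_left _ h2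
    have f₂ : n ^ 5 ≤ t * n ^ 5 := Nat.le_mul_of_pos_left _ ht
    omega
  have hB : n * n * 6 + k * (2 * elimTime n + 26 + 1) + 3 * n + 30 + 1 ≤ 700 * n ^ 5 := by
    have e : n * (2 * elimTime n + 26 + 1) =
        36 * n ^ 4 + 122 * n ^ 3 + 20 * n ^ 2 + 47 * n := by rw [elimTime]; ring
    have f : k * (2 * elimTime n + 26 + 1) ≤ n * (2 * elimTime n + 26 + 1) :=
      Nat.mul_le_mul_right _ hkn
    have g : n * n * 6 = 6 * n ^ 2 := by ring
    omega
  calc _ ≤ 300 * (t * n ^ 5) + 3 ^ k * (700 * n ^ 5) := add_le_add hA (Nat.mul_le_mul_left _ hB)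
    _ ≤ 300 * (3 ^ k * (t * n ^ 5)) + 700 * (3 ^ k * (t * n ^ 5)) := by
        have f₁ : t * n ^ 5 ≤ 3 ^ k * (t * n ^ 5) := Nat.le_mul_of_pos_left _ h3
        have f₂ : 3 ^ k * n ^ 5 ≤ 3 ^ k * (t * n ^ 5) :=
          Nat.mul_le_mul_left _ (Nat.le_mul_of_pos_left _ ht)
        rw [mul_left_comm (3 ^ k) 700]
        omega
    _ = 1000 * (3 ^ k * (t * n ^ 5)) := by ring
    _ ≤ _ := by gcongr

/-- From `3 < 1.7321 ^ 2` one gets `3 ^ ⌈m/2⌉ ≤ 1.7321 ^ (m + 1)`. Of the factor `m ^ 5` only `m ^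
2` is kept, since `m ^ 3 * (1.7321 / 1.7751) ^ m` tends to zero and is therefore bounded. -/
theorem exists_const_bound :
    ∃ C : ℝ, ∀ m t : ℕ, 1 ≤ m → 1 ≤ t →
      ((1000 * (3 ^ ((m + 1) / 2) * (t * (7 * m) ^ 5)) : ℕ) : ℝ) ≤
        C * ((t : ℝ) * (m : ℝ) ^ 2 * (1.7751 : ℝ) ^ m) := by
  obtain ⟨B, hB⟩ := (tendsto_pow_const_mul_const_pow_of_abs_lt_one 3
    (show |(1.7321 / 1.7751 : ℝ)| < 1 by
      rw [abs_of_pos (by norm_num)]; norm_num)).bddAbove_range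
  refine ⟨1000 * 7 ^ 5 * 1.7321 * B, fun m t hm ht => ?_⟩
  have hm3 : (m : ℝ) ^ 3 * (1.7321 : ℝ) ^ m ≤ B * (1.7751 : ℝ) ^ m := by
    have h := hB ⟨m, rfl⟩
    simp only [div_pow] at h
    rwa [← mul_div_assoc, div_le_iff₀ (by positivity)] at h
  have h3 : (3 : ℝ) ^ ((m + 1) / 2) ≤ 1.7321 * (1.7321 : ℝ) ^ m := by
    calc (3 : ℝ) ^ ((m + 1) / 2) ≤ (1.7321 ^ 2) ^ ((m + 1) / 2) := by gcongr; norm_num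
      _ = 1.7321 ^ (2 * ((m + 1) / 2)) := by rw [pow_mul]
      _ ≤ 1.7321 ^ (m + 1) := pow_le_pow_right₀ (by norm_num) (by omega)
      _ = 1.7321 * (1.7321 : ℝ) ^ m := pow_succ' _ _
  push_cast
  calc (1000 * (3 ^ ((m + 1) / 2) * (t * (7 * m) ^ 5)) : ℝ)
      ≤ 1000 * (1.7321 * (1.7321 : ℝ) ^ m * (t * (7 * m) ^ 5)) := by gcongr
    _ = 1000 * 7 ^ 5 * 1.7321 * (t * m ^ 2) * ((m : ℝ) ^ 3 * (1.7321 : ℝ) ^ m) := by ring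
    _ ≤ 1000 * 7 ^ 5 * 1.7321 * (t * m ^ 2) * (B * (1.7751 : ℝ) ^ m) := by gcongr
    _ = _ := by ring

end MonomialTesting

theorem mainTheorem8 :
    ∃ (P : MonomialTesting.Program) (C : ℝ),
      ∀ (m t : ℕ), 1 ≤ m → 1 ≤ t →
      ∀ f : MonomialTesting.Formula, MonomialTesting.IsPiSigmaPi m 3 t f →
        (∃ (T : ℕ) (τ : MonomialTesting.State),
          MonomialTesting.Runs P (MonomialTesting.initialState f) T τ ∧
          (T : ℝ) ≤ C * ((t : ℝ) * (m : ℝ) ^ 2 * (1.7751 : ℝ) ^ m) ∧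
          (MonomialTesting.HasMultilinearMonomial f → τ.reg 0 = 1) ∧
          (¬ MonomialTesting.HasMultilinearMonomial f → τ.reg 0 = 0)) ∧
        (MonomialTesting.HasMultilinearMonomial f ↔
          ∃ d ∈ (MonomialTesting.Formula.toPoly ℤ f).support,
            MonomialTesting.IsMultilinear d) := by
  obtain ⟨C, hC⟩ := MonomialTesting.exists_const_bound
  refine ⟨MonomialTesting.program, C, fun m t hm ht f hf =>
    ⟨?_, MonomialTesting.hasMultilinearMonomial_iff_support f⟩⟩
  obtain ⟨T, τ, hrun, hT, hyes, hno⟩ := MonomialTesting.program_spec hf rfl rfl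
  refine ⟨T, τ, hrun, le_trans ?_ (hC m t hm ht), hyes, hno⟩
  exact_mod_cast hT.trans (MonomialTesting.time_le hm ht rfl rfl)
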